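/- Let $A$ be an associative unital ring, let $\mathfrak C$ be an $A$-coring with comultiplication $\Delta$ and counit $\varepsilon$, and let ${}^*\mathfrak C=\mathrm{Hom}({}_A\mathfrak C,{}_AA)$ be its left dual ring, with product $(f*g)(c)=\sum f(c_{(1)}g(c_{(2)}))$ and unit $\varepsilon$. Let $\mathcal T=(\mathfrak C,B,\langle-,-\rangle)$ be a right rational pairing over $A$: $B$ is an $A$-ring (a ring with a ring homomorphism $A\to B$), and $\langle-,-\rangle:\mathfrak C\times B\to A$ is a balanced $A$-bilinear form such that $\beta:B\to{}^*\mathfrak C$, $b\mapsto\langle-,b\rangle$, is a unital ring anti-morphism and for every right $A$-module $M$ the map $\alpha_M:M\otimes_A\mathfrak C\to\mathrm{Hom}(B_A,M_A)$, $m\otimes c\mapsto[b\mapsto m\langle c,b\rangle]$, is injective. Every right $\mathfrak C$-comodule $X$ is a right $B$-module by $xb=\sum x_{(0)}\langle x_{(1)},b\rangle$. For a right $B$-module $M$ let $\mathrm{Rat}^{\mathcal T}(M)$ be the set of all $m\in M$ for which there are finitely many $(c_i,m_i)\in\mathfrak C\times M$ with $mb=\sum_i m_i\langle c_i,b\rangle$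 for all $b\in B$. It is a $B$-submodule of $M$; the parameters $m_i$ can be chosen in $\mathrm{Rat}^{\mathcal T}(M)$, and then $m\mapsto\sum_i m_i\otimes c_i$ makes $\mathrm{Rat}^{\mathcal T}(M)$ a right $\mathfrak C$-comodule. This gives the rational functor $\mathrm{Rat}^{\mathcal T}$ from right $B$-modules to right $\mathfrak C$-comodules. Assume that $\mathrm{Rat}^{\mathcal T}$ is exact. Let $\Sigma$ be a right $\mathfrak C$-comodule which is a finitely generated and projective object of the category of right $\mathfrak C$-comodules, and let $T_\Sigma=\mathrm{End}_{\mathfrak C}(\Sigma)$, acting on $\Sigma$ from the left. For a comodule $X$, $\mathrm{Hom}_{\mathfrak C}(\Sigma,X)$ is a right $T_\Sigma$-module by composition. Put $\Sigma^\star=\mathrm{Hom}_B(\Sigma,B)$, a $(B,T_\Sigma)$-bimodule, and for a right $T_\Sigma$-module $Y$ put $$\mathrm{Coind}_\Sigma(Y)=\mathrm{Rat}^{\mathcal T}\big(\mathrm{Hom}_{T_\Sigma}(\Sigma^\star,Y)\big),$$ where $(fb)(\varphi)=f(b\varphi)$. Let $\mathcal C_\Sigma$ be the class of comodules $L$ with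 $\mathrm{Hom}_{\mathfrak C}(\Sigma,L)=0$, let $\mathcal T_\Sigma$ be the class of comodules $N$ with $\mathrm{Hom}_{\mathfrak C}(N,L)=0$ for all $L\in\mathcal C_\Sigma$, and for a comodule $X$ let $\mathfrak r_\Sigma(X)=\sum\{\mathrm{Im}(f)\mid f:N\to X,\ N\in\mathcal T_\Sigma\}$, a subcomodule of $X$. Then: (a) If $Y$ is a simple right $T_\Sigma$-module, then $\mathfrak r_\Sigma(\mathrm{Coind}_\Sigma(Y))$ is a simple comodule, and $Y\cong\mathrm{Hom}_{\mathfrak C}\big(\Sigma,\mathfrak r_\Sigma(\mathrm{Coind}_\Sigma(Y))\big)$ as right $T_\Sigma$-modules. Moreover, for simple right $T_\Sigma$-modules $Y$ and $Y'$, one has $Y\cong Y'$ as right $T_\Sigma$-modules if and only if $\mathfrak r_\Sigma(\mathrm{Coind}_\Sigma(Y))\cong\mathfrak r_\Sigma(\mathrm{Coind}_\Sigma(Y'))$ as right $\mathfrak C$-comodules. (b) If $S$ is a simple right $\mathfrak C$-comodule with $\mathrm{Hom}_{\mathfrak C}(\Sigma,S)\neq0$, then $\mathrm{Hom}_{\mathfrak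 C}(\Sigma,S)$ is a simple right $T_\Sigma$-module, and $S\cong\mathfrak r_\Sigma\big(\mathrm{Coind}_\Sigma(\mathrm{Hom}_{\mathfrak C}(\Sigma,S))\big)$ as right $\mathfrak C$-comodules. -/

import Mathlib

/-!
Conventions.  Rings are associative with unit and not necessarily commutative.  A right `A`-module
is a module over `Aᵐᵒᵖ`, so that `x a` is written `op a • x`.
-/

open CategoryTheory MulOpposite
open scoped TensorProduct

universe u

namespace Corings

noncomputable section

/-! ### The balanced tensor product over a noncommutative ring -/

/-- The relations `x a ⊗ y = x ⊗ a y`. -/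
def balancedRel (A M N : Type u) [Ring A] [AddCommGroup M] [Module Aᵐᵒᵖ M]
    [AddCommGroup N] [Module A N] : AddSubgroup (M ⊗[ℤ] N) :=
  AddSubgroup.closure
    {w | ∃ (x : M) (a : A) (y : N), w = (op a • x) ⊗ₜ[ℤ] y - x ⊗ₜ[ℤ] (a • y)}

/-- `M ⊗_A N` for a right `A`-module `M` and a left `A`-module `N`. -/
def BTensor (A M N : Type u) [Ring A] [AddCommGroup M] [Module Aᵐᵒᵖ M]
    [AddCommGroup N] [Module A N] : Type u :=
  (M ⊗[ℤ] N) ⧸ balancedRel A M N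

instance (A M N : Type u) [Ring A] [AddCommGroup M] [Module Aᵐᵒᵖ M]
    [AddCommGroup N] [Module A N] : AddCommGroup (BTensor A M N) :=
  inferInstanceAs (AddCommGroup ((M ⊗[ℤ] N) ⧸ balancedRel A M N))

namespace BTensor

section Basic

variable {A M N P : Type u} [Ring A] [AddCommGroup M] [Module Aᵐᵒᵖ M]
  [AddCommGroup N] [Module A N] [AddCommGroup P]

/-- The pure tensor `x ⊗_A y`. -/
def tmul (A : Type u) [Ring A] [Module Aᵐᵒᵖ M] [Module A N] (x : M) (y : N) : BTensor A M N :=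
  QuotientAddGroup.mk (s := balancedRel A M N) (x ⊗ₜ[ℤ] y)

theorem smul_tmul (a : A) (x : M) (y : N) : tmul A (op a • x) y = tmul A x (a • y) := by
  refine (QuotientAddGroup.eq_iff_sub_mem (N := balancedRel A M N)).2 ?_
  exact AddSubgroup.subset_closure ⟨x, a, y, rfl⟩

theorem add_tmul (x x' : M) (y : N) : tmul A (x + x') y = tmul A x y + tmul A x' y := by
  unfold tmul; rw [TensorProduct.add_tmul]; rfl

theorem tmul_add (x : M) (y y' : N) : tmul A x (y + y') = tmul A x y + tmul A x y' := by
  unfold tmul; rw [TensorProduct.tmul_add]; rfl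

theorem zero_tmul (y : N) : tmul A (0 : M) y = 0 := by
  unfold tmul; rw [TensorProduct.zero_tmul]; rfl

theorem tmul_zero (x : M) : tmul A x (0 : N) = 0 := by
  unfold tmul; rw [TensorProduct.tmul_zero]; rfl

theorem induction {p : BTensor A M N → Prop} (z : BTensor A M N) (h0 : p 0)
    (ht : ∀ x y, p (tmul A x y)) (ha : ∀ z w, p z → p w → p (z + w)) : p z := by
  obtain ⟨w, rfl⟩ := QuotientAddGroup.mk_surjective (s := balancedRel A M N) z
  induction w using TensorProduct.induction_on with
  | zero => exact h0
  | tmul x y => exact ht x y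
  | add z w hz hw => exact ha _ _ hz hw

/-- The universal property: a balanced biadditive map induces an additive map. -/
def lift (f : M →+ N →+ P) (h : ∀ (x : M) (a : A) (y : N), f (op a • x) y = f x (a • y)) :
    BTensor A M N →+ P :=
  QuotientAddGroup.lift (balancedRel A M N)
    (TensorProduct.liftAddHom f (fun r x y => by simp)) (by
      refine (AddSubgroup.closure_le _).2 ?_
      rintro w ⟨x, a, y, rfl⟩
      simp [h])

@[simp] theorem lift_tmul (f : M →+ N →+ P)
    (h : ∀ (x : M) (a : A) (y : N), f (op a • x) y = f x (a • y)) (x : M) (y : N) :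
    lift f h (tmul A x y) = f x y := rfl

theorem addHom_ext {f g : BTensor A M N →+ P} (h : ∀ x y, f (tmul A x y) = g (tmul A x y)) :
    f = g := by
  ext z
  induction z using BTensor.induction with
  | h0 => simp
  | ht x y => exact h x y
  | ha z w hz hw => simp [hz, hw]

/-- Biadditive maps from a function of two variables. -/
def biadd (f : M → N → P) (h1 : ∀ x x' y, f (x + x') y = f x y + f x' y)
    (h2 : ∀ x y y', f x (y + y') = f x y + f x y') : M →+ N →+ P :=
  AddMonoidHom.mk' (fun x => AddMonoidHom.mk' (f x) (h2 x)) (fun x x' => by ext y; exact h1 x x' y)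

@[simp] theorem biadd_apply (f : M → N → P) (h1 : ∀ x x' y, f (x + x') y = f x y + f x' y)
    (h2 : ∀ x y y', f x (y + y') = f x y + f x y') (x : M) (y : N) :
    biadd f h1 h2 x y = f x y := rfl

variable {M' N' : Type u} [AddCommGroup M'] [Module Aᵐᵒᵖ M'] [AddCommGroup N'] [Module A N']

/-- `f ⊗_A g`. -/
def map (f : M →ₗ[Aᵐᵒᵖ] M') (g : N →ₗ[A] N') : BTensor A M N →+ BTensor A M' N' :=
  lift (biadd (fun x y => tmul A (f x) (g y)) (fun x x' y => by simp [add_tmul])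
    (fun x y y' => by simp [tmul_add])) (fun x a y => by simp [smul_tmul])

@[simp] theorem map_tmul (f : M →ₗ[Aᵐᵒᵖ] M') (g : N →ₗ[A] N') (x : M) (y : N) :
    map f g (tmul A x y) = tmul A (f x) (g y) := rfl

@[simp] theorem map_id (z : BTensor A M N) :
    map (LinearMap.id : M →ₗ[Aᵐᵒᵖ] M) (LinearMap.id : N →ₗ[A] N) z = z := by
  have : map (LinearMap.id : M →ₗ[Aᵐᵒᵖ] M) (LinearMap.id : N →ₗ[A] N) = AddMonoidHom.id _ :=
    addHom_ext fun x y => rfl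
  rw [this]; rfl

variable {M'' N'' : Type u} [AddCommGroup M''] [Module Aᵐᵒᵖ M''] [AddCommGroup N''] [Module A N'']

theorem map_map (f : M →ₗ[Aᵐᵒᵖ] M') (g : N →ₗ[A] N') (f' : M' →ₗ[Aᵐᵒᵖ] M'')
    (g' : N' →ₗ[A] N'') (z : BTensor A M N) :
    map f' g' (map f g z) = map (f' ∘ₗ f) (g' ∘ₗ g) z := by
  have : (map f' g').comp (map f g) = map (f' ∘ₗ f) (g' ∘ₗ g) := addHom_ext fun x y => rfl
  exact DFunLike.congr_fun this z

theorem map_add_left (f f' : M →ₗ[Aᵐᵒᵖ] M') (g : N →ₗ[A] N') (z : BTensor A M N) :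
    map (f + f') g z = map f g z + map f' g z := by
  have : map (f + f') g = map f g + map f' g := addHom_ext fun x y => by simp [add_tmul]
  rw [this]; rfl

/-- The contraction `x ⊗ y ↦ x g(y)` along a left linear form `g`. -/
def contractRight (g : N →ₗ[A] A) : BTensor A M N →+ M :=
  lift (biadd (fun x y => op (g y) • x) (fun x x' y => by simp)
    (fun x y y' => by simp [add_smul])) (fun x a y => by simp [mul_smul])

@[simp] theorem contractRight_tmul (g : N →ₗ[A] A) (x : M) (y : N) :
    contractRight g (tmul A x y) = op (g y) • x := rfl

/-- The contraction `x ⊗ y ↦ f(x) y` along a right linear form `f`. -/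
def contractLeft (f : M →ₗ[Aᵐᵒᵖ] A) : BTensor A M N →+ N :=
  lift (biadd (fun x y => f x • y) (fun x x' y => by simp [add_smul])
    (fun x y y' => by simp)) (fun x a y => by simp [mul_smul])

@[simp] theorem contractLeft_tmul (f : M →ₗ[Aᵐᵒᵖ] A) (x : M) (y : N) :
    contractLeft f (tmul A x y) = f x • y := rfl

theorem contractRight_map (f : M →ₗ[Aᵐᵒᵖ] M') (h : N →ₗ[A] N') (g : N' →ₗ[A] A)
    (z : BTensor A M N) :
    contractRight g (map f h z) = f (contractRight (g ∘ₗ h) z) := by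
  have : (contractRight g).comp (map f h)
      = f.toAddMonoidHom.comp (contractRight (M := M) (g ∘ₗ h)) := addHom_ext fun x y => by simp
  exact DFunLike.congr_fun this z

/-- Every element of `M ⊗_A N` is a finite sum of pure tensors. -/
theorem exists_sum (z : BTensor A M N) :
    ∃ (n : ℕ) (y : Fin n → N) (x : Fin n → M), z = ∑ i, tmul A (x i) (y i) := by
  induction z using BTensor.induction with
  | h0 => exact ⟨0, Fin.elim0, Fin.elim0, by simp⟩
  | ht x y => exact ⟨1, fun _ => y, fun _ => x, by simp⟩
  | ha z w hz hw =>
    obtain ⟨n, y, x, rfl⟩ := hz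
    obtain ⟨m, y', x', rfl⟩ := hw
    exact ⟨n + m, Fin.append y y', Fin.append x x', by simp [Fin.sum_univ_add]⟩

end Basic

section RightAction

variable {A M N : Type u} [Ring A] [AddCommGroup M] [Module Aᵐᵒᵖ M]
  [AddCommGroup N] [Module A N] [Module Aᵐᵒᵖ N] [SMulCommClass A Aᵐᵒᵖ N]

/-- Right multiplication by `a` on a bimodule, a left linear map. -/
def rmul (N : Type u) [AddCommGroup N] [Module A N] [Module Aᵐᵒᵖ N] [SMulCommClass A Aᵐᵒᵖ N]
    (a : Aᵐᵒᵖ) : N →ₗ[A] N where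
  toFun y := a • y
  map_add' := smul_add a
  map_smul' r y := (smul_comm r a y).symm

/-- The right action `(x ⊗ y) a = x ⊗ y a` when `N` is a bimodule. -/
instance : Module Aᵐᵒᵖ (BTensor A M N) where
  smul a z := map LinearMap.id (rmul N a) z
  one_smul z := by
    change map LinearMap.id (rmul N 1) z = z
    have : rmul (A := A) N 1 = LinearMap.id := by ext y; exact one_smul _ y
    rw [this, map_id]
  mul_smul a b z := by
    change map LinearMap.id (rmul N (a * b)) z
      = map LinearMap.id (rmul N a) (map LinearMap.id (rmul N b) z)
    rw [map_map]; congr 2; ext y; exact mul_smul a b y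
  smul_zero a := map_zero _
  smul_add a := map_add _
  add_smul a b z := by
    change map LinearMap.id (rmul N (a + b)) z
      = map LinearMap.id (rmul N a) z + map LinearMap.id (rmul N b) z
    have : map (M := M) LinearMap.id (rmul N (a + b))
        = map LinearMap.id (rmul N a) + map LinearMap.id (rmul N b) :=
      addHom_ext fun x y => by simp [rmul, add_smul, tmul_add]
    rw [this]; rfl
  zero_smul z := by
    change map LinearMap.id (rmul N 0) z = 0
    have : map (M := M) LinearMap.id (rmul N (0 : Aᵐᵒᵖ)) = 0 :=
      addHom_ext fun x y => by simp [rmul, tmul_zero]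
    rw [this]; rfl

theorem op_smul_tmul (a : Aᵐᵒᵖ) (x : M) (y : N) : a • tmul A x y = tmul A x (a • y) := rfl

variable {M' : Type u} [AddCommGroup M'] [Module Aᵐᵒᵖ M']

/-- `f ⊗_A N` as a map of right modules, for a bimodule `N`. -/
def mapRight (N : Type u) [AddCommGroup N] [Module A N] [Module Aᵐᵒᵖ N] [SMulCommClass A Aᵐᵒᵖ N]
    (f : M →ₗ[Aᵐᵒᵖ] M') : BTensor A M N →ₗ[Aᵐᵒᵖ] BTensor A M' N where
  toFun := map f LinearMap.id
  map_add' := map_add _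
  map_smul' a z := by
    change map f LinearMap.id (map LinearMap.id (rmul N a) z)
      = map LinearMap.id (rmul N a) (map f LinearMap.id z)
    rw [map_map, map_map]; rfl

theorem mapRight_apply (f : M →ₗ[Aᵐᵒᵖ] M') (z : BTensor A M N) :
    mapRight N f z = map f LinearMap.id z := rfl

@[simp] theorem mapRight_tmul (f : M →ₗ[Aᵐᵒᵖ] M') (x : M) (y : N) :
    mapRight N f (tmul A x y) = tmul A (f x) y := rfl

end RightAction

section LeftAction

variable {A M N : Type u} [Ring A] [AddCommGroup M] [Module Aᵐᵒᵖ M]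
  [Module A M] [SMulCommClass A Aᵐᵒᵖ M] [AddCommGroup N] [Module A N]

/-- Left multiplication by `a` on a bimodule, a right linear map. -/
def lmul (M : Type u) [AddCommGroup M] [Module A M] [Module Aᵐᵒᵖ M] [SMulCommClass A Aᵐᵒᵖ M]
    (a : A) : M →ₗ[Aᵐᵒᵖ] M where
  toFun y := a • y
  map_add' := smul_add a
  map_smul' r y := smul_comm a r y

/-- The left action `a (x ⊗ y) = a x ⊗ y` when `M` is a bimodule. -/
instance : Module A (BTensor A M N) where
  smul a z := map (lmul M a) LinearMap.id z
  one_smul z := by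
    change map (lmul M 1) LinearMap.id z = z
    have : lmul (A := A) M 1 = LinearMap.id := by ext y; exact one_smul _ y
    rw [this, map_id]
  mul_smul a b z := by
    change map (lmul M (a * b)) LinearMap.id z
      = map (lmul M a) LinearMap.id (map (lmul M b) LinearMap.id z)
    rw [map_map]; congr 2; ext y; exact mul_smul a b y
  smul_zero a := map_zero _
  smul_add a := map_add _
  add_smul a b z := by
    change map (lmul M (a + b)) LinearMap.id z
      = map (lmul M a) LinearMap.id z + map (lmul M b) LinearMap.id z
    have : map (N := N) (lmul M (a + b)) LinearMap.id
        = map (lmul M a) LinearMap.id + map (lmul M b) LinearMap.id :=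
      addHom_ext fun x y => by simp [lmul, add_smul, add_tmul]
    rw [this]; rfl
  zero_smul z := by
    change map (lmul M 0) LinearMap.id z = 0
    have : map (N := N) (lmul M (0 : A)) LinearMap.id = 0 :=
      addHom_ext fun x y => by simp [lmul, zero_tmul]
    rw [this]; rfl

theorem smul_tmul' (a : A) (x : M) (y : N) : a • tmul A x y = tmul A (a • x) y := rfl

/-- The contraction `x ⊗ y ↦ x g(y)` is left linear when `M` is a bimodule. -/
def contractRightₗ (M : Type u) [AddCommGroup M] [Module Aᵐᵒᵖ M]
    [Module A M] [SMulCommClass A Aᵐᵒᵖ M] (g : N →ₗ[A] A) : BTensor A M N →ₗ[A] M where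
  toFun := contractRight g
  map_add' := map_add _
  map_smul' a z := by
    change contractRight g (map (lmul M a) LinearMap.id z) = a • contractRight g z
    rw [contractRight_map]; rfl

end LeftAction

section Assoc

variable {A M N P : Type u} [Ring A] [AddCommGroup M] [Module Aᵐᵒᵖ M]
  [AddCommGroup N] [Module A N] [Module Aᵐᵒᵖ N] [SMulCommClass A Aᵐᵒᵖ N]
  [AddCommGroup P] [Module A P]

/-- The associativity map `(x ⊗ y) ⊗ w ↦ x ⊗ (y ⊗ w)`. -/
def assocHom : BTensor A (BTensor A M N) P →+ BTensor A M (BTensor A N P) :=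
  lift
    (AddMonoidHom.flip (AddMonoidHom.mk' (fun w : P =>
      (lift (biadd (fun (x : M) (y : N) => tmul A x (tmul A y w))
          (fun x x' y => add_tmul _ _ _) (fun x y y' => by rw [add_tmul, tmul_add]))
        (fun x a y => by simp [smul_tmul, smul_tmul']) :
          BTensor A M N →+ BTensor A M (BTensor A N P)))
      (fun w w' => addHom_ext fun x y => by
        change tmul A x (tmul A y (w + w')) = tmul A x (tmul A y w) + tmul A x (tmul A y w')
        rw [tmul_add, tmul_add])))
    (fun z a w => by
      induction z using BTensor.induction with
      | h0 => simp
      | ht x y =>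
        change tmul A x (tmul A (op a • y) w) = tmul A x (tmul A y (a • w))
        rw [smul_tmul]
      | ha z w hz hw =>
        rw [smul_add, map_add, map_add, AddMonoidHom.add_apply, AddMonoidHom.add_apply, hz, hw])

@[simp] theorem assocHom_tmul (x : M) (y : N) (w : P) :
    assocHom (tmul A (tmul A x y) w) = tmul A x (tmul A y w) := rfl

/-- The inverse map `x ⊗ (y ⊗ w) ↦ (x ⊗ y) ⊗ w`. -/
def assocInv : BTensor A M (BTensor A N P) →+ BTensor A (BTensor A M N) P :=
  lift
    (AddMonoidHom.mk' (fun x : M =>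
      (lift (biadd (fun (y : N) (w : P) => tmul A (tmul A x y) w)
          (fun y y' w => by rw [tmul_add, add_tmul]) (fun y w w' => tmul_add _ _ _))
        (fun y a w => by simp [← smul_tmul, op_smul_tmul]) :
          BTensor A N P →+ BTensor A (BTensor A M N) P))
      (fun x x' => addHom_ext fun y w => by
        change tmul A (tmul A (x + x') y) w = tmul A (tmul A x y) w + tmul A (tmul A x' y) w
        rw [add_tmul, add_tmul]))
    (fun x a z => by
      induction z using BTensor.induction with
      | h0 => simp
      | ht y w =>
        change tmul A (tmul A (op a • x) y) w = tmul A (tmul A x (a • y)) w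
        rw [smul_tmul]
      | ha z w hz hw => rw [smul_add, map_add, map_add, hz, hw])

@[simp] theorem assocInv_tmul (x : M) (y : N) (w : P) :
    assocInv (tmul A x (tmul A y w)) = tmul A (tmul A x y) w := rfl

/-- `(M ⊗_A N) ⊗_A P ≅ M ⊗_A (N ⊗_A P)`. -/
def assoc (A M N P : Type u) [Ring A] [AddCommGroup M] [Module Aᵐᵒᵖ M]
    [AddCommGroup N] [Module A N] [Module Aᵐᵒᵖ N] [SMulCommClass A Aᵐᵒᵖ N]
    [AddCommGroup P] [Module A P] :
    BTensor A (BTensor A M N) P ≃+ BTensor A M (BTensor A N P) where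
  toFun := assocHom
  invFun := assocInv
  map_add' := map_add _
  left_inv := by
    have : (assocInv (A := A) (M := M) (N := N) (P := P)).comp assocHom = AddMonoidHom.id _ := by
      refine addHom_ext fun z w => ?_
      induction z using BTensor.induction with
      | h0 => simp [zero_tmul]
      | ht x y => rfl
      | ha z w hz hw => rw [add_tmul, map_add, map_add, hz, hw]
    exact fun z => DFunLike.congr_fun this z
  right_inv := by
    have : (assocHom (A := A) (M := M) (N := N) (P := P)).comp assocInv = AddMonoidHom.id _ := by
      refine addHom_ext fun x z => ?_
      induction z using BTensor.induction with
      | h0 => simp [tmul_zero]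
      | ht x y => rfl
      | ha z w hz hw => rw [tmul_add, map_add, map_add, hz, hw]
    exact fun z => DFunLike.congr_fun this z

@[simp] theorem assoc_tmul (x : M) (y : N) (w : P) :
    assoc A M N P (tmul A (tmul A x y) w) = tmul A x (tmul A y w) := rfl

variable {M' : Type u} [AddCommGroup M'] [Module Aᵐᵒᵖ M']

theorem assoc_naturality (f : M →ₗ[Aᵐᵒᵖ] M') (z : BTensor A (BTensor A M N) P) :
    assoc A M' N P (map (mapRight N f) LinearMap.id z)
      = map f LinearMap.id (assoc A M N P z) := by
  have : (assoc A M' N P).toAddMonoidHom.comp (map (mapRight N f) LinearMap.id)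
      = (map f LinearMap.id).comp (assoc A M N P).toAddMonoidHom := by
    refine addHom_ext fun z w => ?_
    induction z using BTensor.induction with
    | h0 => simp [zero_tmul]
    | ht x y => rfl
    | ha z w hz hw => rw [add_tmul, map_add, map_add, hz, hw]
  exact DFunLike.congr_fun this z

theorem map_contract_assoc (g : P →ₗ[A] A) (z : BTensor A (BTensor A M N) P) :
    map LinearMap.id (contractRightₗ N g) (assoc A M N P z) = contractRight g z := by
  have : (map LinearMap.id (contractRightₗ N g)).comp (assoc A M N P).toAddMonoidHom
      = contractRight (M := BTensor A M N) g := by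
    refine addHom_ext fun z w => ?_
    induction z using BTensor.induction with
    | h0 => simp [zero_tmul]
    | ht x y => rfl
    | ha z w hz hw => rw [add_tmul, map_add, map_add, hz, hw]
  exact DFunLike.congr_fun this z

end Assoc

end BTensor

open BTensor

/-! ### Corings and right comodules -/

/-- An `A`-coring structure on an `A`-bimodule `C`. -/
class Coring (A C : Type u) [Ring A] [AddCommGroup C] [Module A C] [Module Aᵐᵒᵖ C]
    [SMulCommClass A Aᵐᵒᵖ C] where
  /-- comultiplication `C → C ⊗_A C`, a map of bimodules -/
  Δ : C →+ BTensor A C C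
  Δ_smul : ∀ (a : A) (c : C), Δ (a • c) = a • Δ c
  Δ_op_smul : ∀ (a : Aᵐᵒᵖ) (c : C), Δ (a • c) = a • Δ c
  /-- counit `C → A`, a map of bimodules -/
  ε : C →+ A
  ε_smul : ∀ (a : A) (c : C), ε (a • c) = a * ε c
  ε_op_smul : ∀ (a : A) (c : C), ε (op a • c) = ε c * a
  coassoc : ∀ c : C,
    assoc A C C C
        (map (⟨⟨Δ, map_add Δ⟩, Δ_op_smul⟩ : C →ₗ[Aᵐᵒᵖ] BTensor A C C) LinearMap.id (Δ c))
      = map LinearMap.id (⟨⟨Δ, map_add Δ⟩, Δ_smul⟩ : C →ₗ[A] BTensor A C C) (Δ c)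
  counit_left : ∀ c : C,
    contractLeft (⟨⟨ε, map_add ε⟩, fun a c => ε_op_smul a.unop c⟩ : C →ₗ[Aᵐᵒᵖ] A) (Δ c) = c
  counit_right : ∀ c : C, contractRight (⟨⟨ε, map_add ε⟩, ε_smul⟩ : C →ₗ[A] A) (Δ c) = c

namespace Coring

variable (A C : Type u) [Ring A] [AddCommGroup C] [Module A C] [Module Aᵐᵒᵖ C]
  [SMulCommClass A Aᵐᵒᵖ C] [Coring A C]

/-- The comultiplication as a left linear map. -/
def comulₗ : C →ₗ[A] BTensor A C C := ⟨⟨Δ, map_add Δ⟩, Δ_smul⟩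

/-- The counit as a left linear map; it is the unit of the left dual ring. -/
def counitₗ : C →ₗ[A] A := ⟨⟨ε, map_add ε⟩, ε_smul⟩

variable {A C}

/-- The product of Sweedler's left dual convolution ring `*C = Hom(_A C, _A A)`:
`(f * g)(c) = ∑ f(c₁ g(c₂))`.  Its unit is the counit of `C`. -/
def conv (f g : C →ₗ[A] A) : C →ₗ[A] A := f ∘ₗ contractRightₗ C g ∘ₗ comulₗ A C

end Coring

/-- Right `C`-comodules: right `A`-modules with a coassociative and counital right `A`-linear
coaction `M → M ⊗_A C`. -/
structure Comod (A C : Type u) [Ring A] [AddCommGroup C] [Module A C] [Module Aᵐᵒᵖ C]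
    [SMulCommClass A Aᵐᵒᵖ C] [Coring A C] : Type (u + 1) where
  carrier : Type u
  [grp : AddCommGroup carrier]
  [mod : Module Aᵐᵒᵖ carrier]
  ρ : carrier →ₗ[Aᵐᵒᵖ] BTensor A carrier C
  coassoc : ∀ x, assoc A carrier C C (map ρ LinearMap.id (ρ x))
    = map LinearMap.id (Coring.comulₗ A C) (ρ x)
  counit : ∀ x, contractRight (Coring.counitₗ A C) (ρ x) = x

namespace Comod

variable {A C : Type u} [Ring A] [AddCommGroup C] [Module A C] [Module Aᵐᵒᵖ C]
  [SMulCommClass A Aᵐᵒᵖ C] [Coring A C]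

instance : CoeSort (Comod A C) (Type u) := ⟨carrier⟩

instance (X : Comod A C) : AddCommGroup X := X.grp

instance (X : Comod A C) : Module Aᵐᵒᵖ X := X.mod

/-- Right `C`-colinear maps. -/
@[ext] structure Hom (X Y : Comod A C) : Type u where
  lin : X →ₗ[Aᵐᵒᵖ] Y
  colinear : ∀ x, Y.ρ (lin x) = map lin LinearMap.id (X.ρ x)

instance : Category (Comod A C) where
  Hom := Hom
  id X := ⟨LinearMap.id, fun x => by simp⟩
  comp f g := ⟨g.lin ∘ₗ f.lin, fun x => by
    rw [LinearMap.comp_apply, g.colinear, f.colinear, map_map]; rfl⟩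

@[ext] theorem hom_ext {X Y : Comod A C} {f g : X ⟶ Y} (h : ∀ x, f.lin x = g.lin x) : f = g :=
  Hom.ext (LinearMap.ext h)

@[simp] theorem id_lin (X : Comod A C) (x : X) : Hom.lin (𝟙 X) x = x := rfl

@[simp] theorem comp_lin {X Y Z : Comod A C} (f : X ⟶ Y) (g : Y ⟶ Z) (x : X) :
    Hom.lin (f ≫ g) x = g.lin (f.lin x) := rfl

section Additive

variable {X Y : Comod A C}

instance : Zero (X ⟶ Y) := ⟨⟨0, fun x => by
  have : map (0 : X →ₗ[Aᵐᵒᵖ] Y) (LinearMap.id : C →ₗ[A] C) = 0 :=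
    addHom_ext fun x y => by simp [zero_tmul]
  rw [this]; simp⟩⟩

instance : Add (X ⟶ Y) := ⟨fun f g => ⟨f.lin + g.lin, fun x => by
  rw [map_add_left, LinearMap.add_apply, map_add, f.colinear, g.colinear]⟩⟩

instance : Neg (X ⟶ Y) := ⟨fun f => ⟨-f.lin, fun x => by
  have : map (-f.lin) (LinearMap.id : C →ₗ[A] C) = -map f.lin LinearMap.id := by
    refine eq_neg_of_add_eq_zero_left (addHom_ext fun x y => ?_)
    simp [← add_tmul, zero_tmul]
  rw [this, LinearMap.neg_apply, map_neg, f.colinear]; rfl⟩⟩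

@[simp] theorem zero_lin (x : X) : Hom.lin (0 : X ⟶ Y) x = 0 := rfl

@[simp] theorem add_lin (f g : X ⟶ Y) (x : X) : Hom.lin (f + g) x = f.lin x + g.lin x := rfl

@[simp] theorem neg_lin (f : X ⟶ Y) (x : X) : Hom.lin (-f) x = -f.lin x := rfl

instance : AddCommGroup (X ⟶ Y) where
  add_assoc f g h := by ext x; simp [add_assoc]
  zero_add f := by ext x; simp
  add_zero f := by ext x; simp
  nsmul := nsmulRec
  zsmul := zsmulRec
  neg_add_cancel f := by ext x; simp
  add_comm f g := by ext x; simp [add_comm]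

end Additive

instance : Preadditive (Comod A C) where
  add_comp X Y Z f g h := by ext x; simp
  comp_add X Y Z f g h := by ext x; simp

/-- A finitely generated object: whenever it is the join of a directed family of subobjects,
it is a member of the family. -/
def FinitelyGenerated (X : Comod A C) : Prop :=
  ∀ D : Set (Subobject X), D.Nonempty → DirectedOn (· ≤ ·) D → IsLUB D ⊤ → ⊤ ∈ D

/-- A subcomodule of `X`: an `A`-submodule `N` such that the coaction maps `N` into
the image of `N ⊗_A C` in `X ⊗_A C`. -/
structure Subcomodule (X : Comod A C) where
  carrier : Submodule Aᵐᵒᵖ X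
  coaction_mem : ∀ x ∈ carrier, X.ρ x ∈ LinearMap.range (mapRight C carrier.subtype)

end Comod

/-- `- ⊗_A C` preserves injections (flatness of `_A C`). -/
def LeftFlat (A C : Type u) [Ring A] [AddCommGroup C] [Module A C] : Prop :=
  ∀ (M N : Type u) [AddCommGroup M] [AddCommGroup N] [Module Aᵐᵒᵖ M] [Module Aᵐᵒᵖ N]
    (f : M →ₗ[Aᵐᵒᵖ] N), Function.Injective f →
    Function.Injective (map f (LinearMap.id : C →ₗ[A] C))

namespace Comod

variable {A C : Type u} [Ring A] [AddCommGroup C] [Module A C] [Module Aᵐᵒᵖ C]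
  [SMulCommClass A Aᵐᵒᵖ C] [Coring A C]

namespace Subcomodule

variable {X : Comod A C} (N : X.Subcomodule)

/-- The restriction of the coaction to a subcomodule, for flat `_A C`. -/
def coaction (hC : LeftFlat A C) : N.carrier →ₗ[Aᵐᵒᵖ] BTensor A N.carrier C where
  toFun x := (N.coaction_mem x x.2).choose
  map_add' x y := by
    apply hC _ _ _ N.carrier.subtype_injective
    simp only [← mapRight_apply]
    rw [map_add, (N.coaction_mem x x.2).choose_spec, (N.coaction_mem y y.2).choose_spec,
      (N.coaction_mem _ (x + y).2).choose_spec]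
    exact map_add X.ρ _ _
  map_smul' a x := by
    apply hC _ _ _ N.carrier.subtype_injective
    simp only [← mapRight_apply]
    rw [map_smul, (N.coaction_mem x x.2).choose_spec,
      (N.coaction_mem _ (a • x).2).choose_spec]
    exact map_smul X.ρ _ _

theorem coaction_spec (hC : LeftFlat A C) (x : N.carrier) :
    map N.carrier.subtype LinearMap.id (N.coaction hC x) = X.ρ x :=
  (N.coaction_mem x x.2).choose_spec

/-- A subcomodule as a comodule (for flat `_A C`): the inclusion is colinear. -/
def toComod (hC : LeftFlat A C) : Comod A C where
  carrier := N.carrier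
  ρ := N.coaction hC
  coassoc x := by
    have hi := N.carrier.subtype_injective
    have hi2 : Function.Injective (mapRight C N.carrier.subtype) := hC _ _ _ hi
    apply (assoc A N.carrier C C).symm.injective
    apply hC _ _ _ hi2
    apply (assoc A X C C).injective
    rw [AddEquiv.symm_apply_apply, assoc_naturality, assoc_naturality, AddEquiv.apply_symm_apply,
      ← assoc_naturality, map_map]
    have h1 := X.coassoc x
    rw [← N.coaction_spec hC x, map_map, map_map] at h1
    rw [LinearMap.id_comp, LinearMap.comp_id] at h1
    rw [map_map, LinearMap.comp_id]
    refine Eq.trans ?_ h1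
    have h2 : mapRight C N.carrier.subtype ∘ₗ N.coaction hC = X.ρ ∘ₗ N.carrier.subtype :=
      LinearMap.ext fun y => N.coaction_spec hC y
    rw [h2]
  counit x := by
    apply N.carrier.subtype_injective
    have h := X.counit x
    rw [← N.coaction_spec hC x, contractRight_map] at h
    exact h

/-- The inclusion of a subcomodule. -/
def ι (hC : LeftFlat A C) : N.toComod hC ⟶ X :=
  ⟨N.carrier.subtype, fun x => (N.coaction_spec hC x).symm⟩

end Subcomodule

/-- The class of comodules `L` with `Hom_C(Σ, L) = 0`. -/
def IsTorsionFree (S L : Comod A C) : Prop := ∀ f : S ⟶ L, f = 0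

/-- The class of comodules `M` with `Hom_C(M, L) = 0` for all `L` with `Hom_C(Σ, L) = 0`. -/
def IsTorsion (S M : Comod A C) : Prop :=
  ∀ L : Comod A C, IsTorsionFree S L → ∀ f : M ⟶ L, f = 0

/-- The subcomodule `r_Σ(X) = ∑ {Im f | f : N → X, N torsion}` of `X`. -/
def torsionPart (S X : Comod A C) : X.Subcomodule where
  carrier := ⨆ (N : Comod A C) (_ : IsTorsion S N) (f : N ⟶ X), LinearMap.range f.lin
  coaction_mem := by
    set R : Submodule Aᵐᵒᵖ X :=
      ⨆ (N : Comod A C) (_ : IsTorsion S N) (f : N ⟶ X), LinearMap.range f.lin with hR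
    suffices h : R ≤ (LinearMap.range (mapRight C R.subtype)).comap X.ρ from fun x hx => h hx
    refine iSup_le fun N => iSup_le fun hN => iSup_le fun f => ?_
    have hle : LinearMap.range f.lin ≤ R :=
      le_iSup_of_le N (le_iSup_of_le hN (le_iSup (fun f : N ⟶ X => LinearMap.range f.lin) f))
    rintro _ ⟨x, rfl⟩
    refine ⟨mapRight C (f.lin.codRestrict R fun y => hle ⟨y, rfl⟩) (N.ρ x), ?_⟩
    rw [f.colinear, mapRight_apply, mapRight_apply, map_map]
    rfl

/-- The idempotent radical `r_Σ` of the torsion theory of `Σ`, on objects. -/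
def radical (hC : LeftFlat A C) (S X : Comod A C) : Comod A C := (torsionPart S X).toComod hC

end Comod

/-! ### Rational pairings and the rational functor -/

/-- A right rational pairing `(C, B, ⟨-,-⟩)` over `A`: `B` is an `A`-ring via `ι`, the form is a
balanced `A`-bilinear form, `β : B → *C` is a ring anti-morphism, and all the maps
`α_M : M ⊗_A C → Hom(B_A, M)`, `x ⊗ c ↦ [b ↦ x ⟨c, b⟩]` are injective. -/
structure RationalPairing (A C B : Type u) [Ring A] [AddCommGroup C] [Module A C]
    [Module Aᵐᵒᵖ C] [SMulCommClass A Aᵐᵒᵖ C] [Coring A C] [Ring B] where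
  /-- the ring extension `A → B` -/
  ι : A →+* B
  /-- the form `⟨c, b⟩` -/
  form : C →+ B →+ A
  form_smul : ∀ (a : A) (c : C) (b : B), form (a • c) b = a * form c b
  form_balanced : ∀ (a : A) (c : C) (b : B), form (op a • c) b = form c (ι a * b)
  form_mul : ∀ (a : A) (c : C) (b : B), form c (b * ι a) = form c b * a
  /-- `β(1)` is the unit of the left dual ring -/
  β_one : (⟨⟨fun c => form c 1, fun c c' => by simp⟩, fun a c => form_smul a c 1⟩ : C →ₗ[A] A)
    = Coring.counitₗ A C
  /-- `β(b b') = β(b') * β(b)` in the left dual ring -/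
  β_mul : ∀ b b' : B,
    (⟨⟨fun c => form c (b * b'), fun c c' => by simp⟩, fun a c => form_smul a c (b * b')⟩ :
        C →ₗ[A] A)
      = Coring.conv
          (⟨⟨fun c => form c b', fun c c' => by simp⟩, fun a c => form_smul a c b'⟩)
          (⟨⟨fun c => form c b, fun c c' => by simp⟩, fun a c => form_smul a c b⟩)
  α_injective : ∀ (M : Type u) [AddCommGroup M] [Module Aᵐᵒᵖ M],
    Function.Injective (fun (z : BTensor A M C) (b : B) =>
      contractRight
        (⟨⟨fun c => form c b, fun c c' => by simp⟩, fun a c => form_smul a c b⟩ : C →ₗ[A] A) z)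

namespace RationalPairing

variable {A C B : Type u} [Ring A] [AddCommGroup C] [Module A C]
  [Module Aᵐᵒᵖ C] [SMulCommClass A Aᵐᵒᵖ C] [Coring A C] [Ring B]
  (T : RationalPairing A C B)

/-- The map `β : B → *C`, `b ↦ ⟨-, b⟩`. -/
def β (b : B) : C →ₗ[A] A :=
  ⟨⟨fun c => T.form c b, fun c c' => by simp⟩, fun a c => T.form_smul a c b⟩

@[simp] theorem β_apply (b : B) (c : C) : T.β b c = T.form c b := rfl

theorem eq_of_contract {M : Type u} [AddCommGroup M] [Module Aᵐᵒᵖ M] {z w : BTensor A M C}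
    (h : ∀ b, contractRight (T.β b) z = contractRight (T.β b) w) : z = w :=
  T.α_injective M (funext h)

theorem contract_add {M : Type u} [AddCommGroup M] [Module Aᵐᵒᵖ M] (b b' : B)
    (z : BTensor A M C) :
    contractRight (T.β (b + b')) z = contractRight (T.β b) z + contractRight (T.β b') z := by
  have : contractRight (M := M) (T.β (b + b'))
      = contractRight (T.β b) + contractRight (T.β b') := addHom_ext fun x y => by simp [add_smul]
  rw [this]; rfl

theorem contract_zero {M : Type u} [AddCommGroup M] [Module Aᵐᵒᵖ M] (z : BTensor A M C) :
    contractRight (T.β 0) z = 0 := by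
  have : contractRight (M := M) (T.β 0) = 0 := addHom_ext fun x y => by simp
  rw [this]; rfl

theorem contract_mul {M : Type u} [AddCommGroup M] [Module Aᵐᵒᵖ M] (b b' : B)
    (z : BTensor A M C) :
    contractRight (T.β b')
        (map LinearMap.id (contractRightₗ C (T.β b) ∘ₗ Coring.comulₗ A C) z)
      = contractRight (T.β (b * b')) z := by
  rw [contractRight_map, show T.β (b * b') = Coring.conv (T.β b') (T.β b) from T.β_mul b b']
  rfl

theorem contract_op_smul {M : Type u} [AddCommGroup M] [Module Aᵐᵒᵖ M] (a : A) (b : B)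
    (z : BTensor A M C) :
    contractRight (T.β b) (op a • z) = contractRight (T.β (T.ι a * b)) z := by
  change contractRight (T.β b) (map LinearMap.id (rmul C (op a)) z) = _
  rw [contractRight_map, LinearMap.id_apply]
  congr 2
  ext c
  exact T.form_balanced a c b

theorem leftFlat (T : RationalPairing A C B) : LeftFlat A C := by
  intro M N _ _ _ _ f hf
  rw [injective_iff_map_eq_zero]
  intro z hz
  refine T.eq_of_contract fun b => hf ?_
  have := contractRight_map f LinearMap.id (T.β b) z
  rw [hz] at this
  simpa using this.symm

/-! #### Comodules as right `B`-modules -/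

/-- The underlying type of the right `B`-module of a right comodule. -/
def ToMod (_ : RationalPairing A C B) (X : Comod A C) : Type u := X

instance (X : Comod A C) : AddCommGroup (T.ToMod X) := inferInstanceAs (AddCommGroup X)

/-- The element `x b = ∑ x₀ ⟨x₁, b⟩` of a right comodule. -/
def act (X : Comod A C) (b : B) (x : X) : X := BTensor.contractRight (T.β b) (X.ρ x)

theorem act_add (X : Comod A C) (b : B) (x y : X) :
    T.act X b (x + y) = T.act X b x + T.act X b y := by simp [act]

theorem act_act (X : Comod A C) (b b' : B) (x : X) :
    T.act X b' (T.act X b x) = T.act X (b * b') x := by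
  have h : X.ρ (T.act X b x)
      = BTensor.map LinearMap.id (BTensor.contractRightₗ C (T.β b) ∘ₗ Coring.comulₗ A C)
          (X.ρ x) := by
    have h1 := contractRight_map X.ρ LinearMap.id (T.β b) (X.ρ x)
    rw [LinearMap.comp_id] at h1
    rw [act, ← h1, ← map_contract_assoc, X.coassoc, map_map]
    rfl
  rw [act, h, T.contract_mul, act]

/-- The right `B`-action `x b = ∑ x₀ ⟨x₁, b⟩` on a right comodule. -/
instance (X : Comod A C) : Module Bᵐᵒᵖ (T.ToMod X) where
  smul b x := T.act X b.unop x
  one_smul x := by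
    change BTensor.contractRight (T.β 1) (X.ρ x) = x
    rw [show T.β 1 = Coring.counitₗ A C from T.β_one]
    exact X.counit x
  mul_smul b' b x := (T.act_act X b.unop b'.unop x).symm
  smul_zero b := by
    change T.act X b.unop 0 = 0
    simp [act]
  smul_add b x y := T.act_add X b.unop x y
  add_smul b b' x := T.contract_add _ _ (X.ρ x)
  zero_smul x := T.contract_zero (X.ρ x)

theorem toMod_smul_def (X : Comod A C) (b : B) (x : T.ToMod X) : op b • x = T.act X b x := rfl

theorem lin_act {X Y : Comod A C} (f : X ⟶ Y) (b : B) (x : X) :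
    f.lin (T.act X b x) = T.act Y b (f.lin x) := by
  rw [act, act, f.colinear, contractRight_map]
  rfl

/-- A colinear map is right `B`-linear. -/
def toModMap {X Y : Comod A C} (f : X ⟶ Y) : T.ToMod X →ₗ[Bᵐᵒᵖ] T.ToMod Y where
  toFun x := f.lin x
  map_add' x y := map_add f.lin x y
  map_smul' b x := T.lin_act f b.unop x

/-! #### The rational functor -/

/-- A right `B`-module as a right `A`-module through `ι : A → B`. -/
def Res (_ : RationalPairing A C B) (M : Type u) : Type u := M

variable (M : Type u) [AddCommGroup M] [Module Bᵐᵒᵖ M]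

instance : AddCommGroup (T.Res M) := inferInstanceAs (AddCommGroup M)

instance : Module Bᵐᵒᵖ (T.Res M) := inferInstanceAs (Module Bᵐᵒᵖ M)

instance : Module Aᵐᵒᵖ (T.Res M) := Module.compHom M T.ι.op

theorem res_smul_def (a : A) (x : T.Res M) : op a • x = op (T.ι a) • x := rfl

variable {M}

/-- An element `m` is rational if `m b = ∑ mᵢ ⟨cᵢ, b⟩` for all `b`, for some finite family of
right rational parameters `(cᵢ, mᵢ)`. -/
def IsRational (m : M) : Prop :=
  ∃ (n : ℕ) (c : Fin n → C) (x : Fin n → M), ∀ b : B,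
    op b • m = ∑ i, op (T.ι (T.form (c i) b)) • x i

theorem isRational_iff (m : M) :
    T.IsRational m ↔ ∃ z : BTensor A (T.Res M) C, ∀ b : B,
      (contractRight (T.β b) z : T.Res M) = op b • m := by
  constructor
  · rintro ⟨n, c, x, h⟩
    refine ⟨∑ i, tmul A (show T.Res M from x i) (c i), fun b => ?_⟩
    rw [map_sum, h]
    rfl
  · rintro ⟨z, h⟩
    obtain ⟨n, c, x, rfl⟩ := z.exists_sum
    refine ⟨n, c, x, fun b => ?_⟩
    rw [← h, map_sum]
    rfl

variable (M)

/-- The `B`-submodule of rational elements of `M`. -/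
def ratSubmodule : Submodule Bᵐᵒᵖ M where
  carrier := {m | T.IsRational m}
  zero_mem' := (T.isRational_iff _).2 ⟨0, fun b => by rw [map_zero, smul_zero]; rfl⟩
  add_mem' := by
    intro m m' h h'
    obtain ⟨z, hz⟩ := (T.isRational_iff _).1 h
    obtain ⟨z', hz'⟩ := (T.isRational_iff _).1 h'
    exact (T.isRational_iff _).2 ⟨z + z', fun b => by rw [map_add, hz, hz', smul_add]; rfl⟩
  smul_mem' := by
    intro b m h
    obtain ⟨z, hz⟩ := (T.isRational_iff _).1 h
    refine (T.isRational_iff _).2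
      ⟨map LinearMap.id (contractRightₗ C (T.β b.unop) ∘ₗ Coring.comulₗ A C) z, fun b' => ?_⟩
    rw [T.contract_mul, hz, smul_smul]
    rfl

/-- The inclusion of the rational part, as a map of right `A`-modules. -/
def ratIncl : T.Res (T.ratSubmodule M) →ₗ[Aᵐᵒᵖ] T.Res M where
  toFun x := x.1
  map_add' _ _ := rfl
  map_smul' _ _ := rfl

theorem ratIncl_injective : Function.Injective (T.ratIncl M) := Subtype.val_injective

end RationalPairing

namespace BTensor

variable {A M N : Type u} [Ring A] [AddCommGroup M] [Module Aᵐᵒᵖ M] [AddCommGroup N] [Module A N]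

/-- Right exactness of `- ⊗_A N`, in the form needed below. -/
theorem mem_range_of_mkQ (K : Submodule Aᵐᵒᵖ M) (z : BTensor A M N)
    (hz : map K.mkQ (LinearMap.id : N →ₗ[A] N) z = 0) :
    ∃ w : BTensor A K N, map K.subtype LinearMap.id w = z := by
  let I : AddSubgroup (BTensor A M N) :=
    (map K.subtype (LinearMap.id : N →ₗ[A] N)).range
  let q : M →+ N →+ (BTensor A M N ⧸ I) :=
    biadd (fun x y => QuotientAddGroup.mk (tmul A x y)) (fun x x' y => by rw [add_tmul]; rfl)
      (fun x y y' => by rw [tmul_add]; rfl)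
  have hq : K.toAddSubgroup ≤ q.ker := by
    intro x hx
    refine AddMonoidHom.ext fun y => ?_
    exact (QuotientAddGroup.eq_zero_iff _).2 ⟨tmul A (⟨x, hx⟩ : K) y, rfl⟩
  let g : BTensor A (M ⧸ K) N →+ (BTensor A M N ⧸ I) :=
    lift (QuotientAddGroup.lift K.toAddSubgroup q hq) (by
      intro x a y
      obtain ⟨x, rfl⟩ := K.mkQ_surjective x
      exact congrArg QuotientAddGroup.mk (smul_tmul a x y))
  have h : g.comp (map K.mkQ LinearMap.id) = QuotientAddGroup.mk' I :=
    addHom_ext fun x y => rfl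
  have h2 := DFunLike.congr_fun h z
  rw [AddMonoidHom.comp_apply, hz, map_zero] at h2
  exact (QuotientAddGroup.eq_zero_iff z).1 h2.symm

end BTensor

namespace RationalPairing

variable {A C B : Type u} [Ring A] [AddCommGroup C] [Module A C]
  [Module Aᵐᵒᵖ C] [SMulCommClass A Aᵐᵒᵖ C] [Coring A C] [Ring B]
  (T : RationalPairing A C B) (M : Type u) [AddCommGroup M] [Module Bᵐᵒᵖ M]

/-- Rational elements have rational parameters in the rational part. -/
theorem exists_ratCoaction (x : T.Res (T.ratSubmodule M)) :
    ∃ z : BTensor A (T.Res (T.ratSubmodule M)) C, ∀ b : B, contractRight (T.β b) z = op b • x := by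
  obtain ⟨z, hz⟩ := (T.isRational_iff _).1 x.2
  let K : Submodule Aᵐᵒᵖ (T.Res M) := LinearMap.range (T.ratIncl M)
  have hK : map K.mkQ (LinearMap.id : C →ₗ[A] C) z = 0 := by
    refine T.eq_of_contract fun b => ?_
    rw [contractRight_map, LinearMap.comp_id, hz, map_zero]
    exact (Submodule.Quotient.mk_eq_zero K).2 ⟨op b • x, rfl⟩
  obtain ⟨w, hw⟩ := mem_range_of_mkQ K z hK
  let e : K →ₗ[Aᵐᵒᵖ] T.Res (T.ratSubmodule M) :=
    (LinearEquiv.ofInjective (T.ratIncl M) (T.ratIncl_injective M)).symm.toLinearMap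
  have he : T.ratIncl M ∘ₗ e = K.subtype := by
    refine LinearMap.ext fun y => ?_
    exact congrArg Subtype.val
      ((LinearEquiv.ofInjective (T.ratIncl M) (T.ratIncl_injective M)).apply_symm_apply y)
  refine ⟨map e LinearMap.id w, fun b => T.ratIncl_injective M ?_⟩
  have h := contractRight_map (T.ratIncl M) LinearMap.id (T.β b) (map e LinearMap.id w)
  rw [map_map, he, LinearMap.comp_id, LinearMap.comp_id, hw, hz] at h
  exact h.symm

/-- The coaction on the rational part: `ρ(m) = ∑ mᵢ ⊗ cᵢ` where `m b = ∑ mᵢ ⟨cᵢ, b⟩`. -/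
def ratCoaction :
    T.Res (T.ratSubmodule M) →ₗ[Aᵐᵒᵖ] BTensor A (T.Res (T.ratSubmodule M)) C where
  toFun x := (T.exists_ratCoaction M x).choose
  map_add' x y := T.eq_of_contract fun b => by
    rw [map_add, (T.exists_ratCoaction M x).choose_spec, (T.exists_ratCoaction M y).choose_spec,
      (T.exists_ratCoaction M (x + y)).choose_spec, smul_add]
  map_smul' a x := T.eq_of_contract fun b => by
    induction a using MulOpposite.rec' with
    | h a =>
    rw [(T.exists_ratCoaction M _).choose_spec, RingHom.id_apply, T.contract_op_smul,
      (T.exists_ratCoaction M _).choose_spec, T.res_smul_def, smul_smul]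
    rfl

theorem contract_ratCoaction (b : B) (x : T.Res (T.ratSubmodule M)) :
    contractRight (T.β b) (T.ratCoaction M x) = op b • x :=
  (T.exists_ratCoaction M x).choose_spec b

/-- The right `C`-comodule `Rat(M)` of a right `B`-module `M`. -/
def ratObj : Comod A C where
  carrier := T.Res (T.ratSubmodule M)
  ρ := T.ratCoaction M
  coassoc x := by
    apply (assoc A _ C C).symm.injective
    refine T.eq_of_contract fun b => T.eq_of_contract fun b' => ?_
    rw [AddEquiv.symm_apply_apply, contractRight_map, LinearMap.comp_id, T.contract_ratCoaction,
      T.contract_ratCoaction, ← map_contract_assoc (T.β b), AddEquiv.apply_symm_apply, map_map,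
      LinearMap.comp_id, T.contract_mul, T.contract_ratCoaction, smul_smul]
    rfl
  counit x := by
    have h := T.contract_ratCoaction M 1 x
    rw [show T.β 1 = Coring.counitₗ A C from T.β_one] at h
    rw [h]
    exact one_smul _ x

variable {M} {N : Type u} [AddCommGroup N] [Module Bᵐᵒᵖ N]

theorem IsRational.map (f : M →ₗ[Bᵐᵒᵖ] N) {m : M} (h : T.IsRational m) :
    T.IsRational (f m) := by
  obtain ⟨n, c, x, h⟩ := h
  exact ⟨n, c, fun i => f (x i), fun b => by rw [← map_smul, h, map_sum]; simp⟩

/-- `Rat` on morphisms: restriction to rational parts. -/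
def ratMap (f : M →ₗ[Bᵐᵒᵖ] N) : T.ratObj M ⟶ T.ratObj N where
  lin :=
    { toFun := fun x => (⟨f x.1, IsRational.map T f x.2⟩ : T.ratSubmodule N)
      map_add' := fun x y => Subtype.ext (map_add f x.1 y.1)
      map_smul' := fun a x => Subtype.ext (map_smul f (T.ι.op a) x.1) }
  colinear x := T.eq_of_contract fun b => by
    rw [contractRight_map, LinearMap.comp_id]
    erw [T.contract_ratCoaction, T.contract_ratCoaction]
    exact Subtype.ext (map_smul f (op b) x.1).symm

/-- The right rational functor from right `B`-modules to right `C`-comodules. -/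
def ratFunctor : ModuleCat.{u} Bᵐᵒᵖ ⥤ Comod A C where
  obj M := T.ratObj M
  map f := T.ratMap f.hom
  map_id _ := rfl
  map_comp _ _ := rfl

/-- Exactness of the rational functor. -/
def RatExact : Prop :=
  Limits.PreservesFiniteLimits T.ratFunctor ∧
    Limits.PreservesFiniteColimits T.ratFunctor

/-! #### The coinduction functor -/

/-- `Σ* = Hom_B(Σ, B)`. -/
def Dual (S : Comod A C) : Type u := T.ToMod S →ₗ[Bᵐᵒᵖ] B

variable (S : Comod A C)

instance : FunLike (T.Dual S) (T.ToMod S) B :=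
  inferInstanceAs (FunLike (T.ToMod S →ₗ[Bᵐᵒᵖ] B) (T.ToMod S) B)

instance : AddCommGroup (T.Dual S) := inferInstanceAs (AddCommGroup (T.ToMod S →ₗ[Bᵐᵒᵖ] B))

/-- The left `B`-action `(b φ)(x) = b φ(x)` on `Σ*`. -/
instance : Module B (T.Dual S) := inferInstanceAs (Module B (T.ToMod S →ₗ[Bᵐᵒᵖ] B))

/-- The right action `(φ t)(x) = φ(t(x))` of the endomorphism ring on `Σ*`. -/
instance : Module (End S)ᵐᵒᵖ (T.Dual S) where
  smul t φ := LinearMap.comp φ (T.toModMap t.unop)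
  one_smul _ := rfl
  mul_smul _ _ _ := rfl
  smul_zero _ := rfl
  smul_add _ _ _ := rfl
  add_smul t t' φ := LinearMap.ext fun x =>
    LinearMap.map_add (φ : T.ToMod S →ₗ[Bᵐᵒᵖ] B) (t.unop.lin x) (t'.unop.lin x)
  zero_smul φ := LinearMap.ext fun _ => LinearMap.map_zero (φ : T.ToMod S →ₗ[Bᵐᵒᵖ] B)

theorem dual_smul_apply (b : B) (φ : T.Dual S) (x : T.ToMod S) : (b • φ) x = b * φ x := rfl

theorem dual_op_smul_apply (t : End S) (φ : T.Dual S) (x : T.ToMod S) :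
    (op t • φ) x = φ (T.toModMap t x) := rfl

instance : SMulCommClass B (End S)ᵐᵒᵖ (T.Dual S) := ⟨fun _ _ _ => rfl⟩

variable (Y : Type u) [AddCommGroup Y] [Module (End S)ᵐᵒᵖ Y]

/-- `Hom_T(Σ*, Y)` for a right module `Y` over the endomorphism ring `T` of `Σ`. -/
def HomDual : Type u := T.Dual S →ₗ[(End S)ᵐᵒᵖ] Y

instance : FunLike (T.HomDual S Y) (T.Dual S) Y :=
  inferInstanceAs (FunLike (T.Dual S →ₗ[(End S)ᵐᵒᵖ] Y) (T.Dual S) Y)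

instance : AddCommGroup (T.HomDual S Y) :=
  inferInstanceAs (AddCommGroup (T.Dual S →ₗ[(End S)ᵐᵒᵖ] Y))

/-- The right `B`-action `(f b)(φ) = f(b φ)` on `Hom_T(Σ*, Y)`. -/
instance : Module Bᵐᵒᵖ (T.HomDual S Y) where
  smul b f := LinearMap.comp f
    ({ toFun := fun φ => b.unop • φ
       map_add' := smul_add _
       map_smul' := fun t φ => smul_comm b.unop t φ } : T.Dual S →ₗ[(End S)ᵐᵒᵖ] T.Dual S)
  one_smul f := LinearMap.ext fun φ => congrArg (fun ψ => f ψ) (one_smul B φ)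
  mul_smul b b' f := LinearMap.ext fun φ =>
    congrArg (fun ψ => f ψ) (mul_smul b'.unop b.unop φ)
  smul_zero _ := rfl
  smul_add _ _ _ := rfl
  add_smul b b' f := LinearMap.ext fun φ =>
    (congrArg (fun ψ => f ψ) (add_smul b.unop b'.unop φ)).trans
      (LinearMap.map_add (f : T.Dual S →ₗ[(End S)ᵐᵒᵖ] Y) _ _)
  zero_smul f := LinearMap.ext fun φ =>
    (congrArg (fun ψ => f ψ) (zero_smul B φ)).trans
      (LinearMap.map_zero (f : T.Dual S →ₗ[(End S)ᵐᵒᵖ] Y))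

theorem homDual_op_smul_apply (b : B) (f : T.HomDual S Y) (φ : T.Dual S) :
    (op b • f) φ = f (b • φ) := rfl

/-- The coinduction functor `Coind_Σ = Rat ∘ Hom_T(Σ*, -)`, on objects. -/
def coind : Comod A C := T.ratObj (T.HomDual S Y)

/-- The torsion part `r_Σ(Coind_Σ(Y))`. -/
def torsionCoind : Comod A C := Comod.radical T.leftFlat S (T.coind S Y)

end RationalPairing

end

end Corings

open Corings

/-!
Let `F = Hom_C(Σ, -)`, with values in right modules over `T_Σ = End_C(Σ)`.  The comodules are, via
`x b = ∑ x₀ ⟨x₁, b⟩`, right `B`-modules all of whose elements are rational, and colinear maps are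
the same as `B`-linear maps.  Hence `Hom_C(X, Rat M) = Hom_B(X, M)` (`toRat`, `ofRat`).

As `Rat` is exact, it preserves epimorphisms, so a projective comodule `Σ` is projective with
respect to surjections of `B`-modules; a finitely generated comodule is finitely generated over `B`
because `B`-submodules are subcomodules.  Therefore `Σ` has a finite dual basis
`(xᵢ, φᵢ)` over `B` (`exists_dualBasis`).

Rank one maps `s ↦ x φ(s)` turn `T_Σ`-linear maps `F(X) → Y` into colinear maps `X → Coind(Y)`
(`coindLift`).  The dual basis gives `F(Coind Y) ≅ Y` (`toHomCoind_bijective`) and shows that a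
comodule `X` with `F(X) = 0` has no nonzero map to `Coind(Y)` (`hom_coind_eq_zero`).

Let `Y` be simple and `R = r(Coind Y)`.  Since `Σ` is torsion, `F(R) = F(Coind Y) ≅ Y`.  A nonzero
subcomodule `K` of `R` has `F(K) ≠ 0`, so `F(K) = F(R)` by simplicity of `Y`, so `F(R/K) = 0` by
projectivity of `Σ`; as `R` is torsion, `R/K = 0`.  Thus `R` is simple (`simple_torsionCoind`).

Conversely, if `X` is simple and `F(X) ≠ 0`, then `X` is a quotient of `Σ`, whence `F(X)` is simple
(`isSimpleModule_hom`) and `X` is torsion.  Any isomorphism `F(X) ≅ Y` yields a nonzero map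
`X → Coind(Y)`, which lands in `R`, and a nonzero map between the simple comodules `X` and `R` is an
isomorphism (`nonempty_iso_torsionCoind`).  Below, `Σ` is written `S`.
-/

namespace Corings

open BTensor

noncomputable section

namespace Comod

/-! ### Morphisms of comodules -/

section

variable {A C : Type u} [Ring A] [AddCommGroup C] [Module A C] [Module Aᵐᵒᵖ C]
  [SMulCommClass A Aᵐᵒᵖ C] [Coring A C] {X Y Z : Comod A C}

theorem mono_of_injective (f : X ⟶ Y) (hf : Function.Injective f.lin) : Mono f :=
  ⟨fun _ _ e => hom_ext fun x => hf (congrArg (fun k => Hom.lin k x) e)⟩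

theorem epi_of_surjective (f : X ⟶ Y) (hf : Function.Surjective f.lin) : Epi f :=
  ⟨fun _ _ e => hom_ext fun y => by
    obtain ⟨x, rfl⟩ := hf y
    exact congrArg (fun k => Hom.lin k x) e⟩

theorem isIso_of_bijective (f : X ⟶ Y) (hf : Function.Bijective f.lin) : IsIso f := by
  let e := LinearEquiv.ofBijective f.lin hf
  have he : e.symm.toLinearMap ∘ₗ f.lin = LinearMap.id :=
    LinearMap.ext fun x => e.symm_apply_apply x
  refine ⟨⟨e.symm.toLinearMap, fun y => ?_⟩, hom_ext fun x => e.symm_apply_apply x,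
    hom_ext fun y => e.apply_symm_apply y⟩
  obtain ⟨x, rfl⟩ := hf.2 y
  rw [f.colinear, map_map, he, LinearMap.comp_id, map_id]
  exact congrArg X.ρ (e.symm_apply_apply x)

theorem bijective_of_isIso (f : X ⟶ Y) [IsIso f] : Function.Bijective f.lin := by
  refine Function.bijective_iff_has_inverse.2 ⟨(inv f).lin, fun x => ?_, fun y => ?_⟩
  · exact congrArg (fun k => Hom.lin k x) (IsIso.hom_inv_id f)
  · exact congrArg (fun k => Hom.lin k y) (IsIso.inv_hom_id f)

/-- A colinear map with values in a subcomodule, as a map to the subcomodule. -/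
def Subcomodule.lift (hC : LeftFlat A C) (N : Z.Subcomodule) (g : X ⟶ Z)
    (h : ∀ x, g.lin x ∈ N.carrier) : X ⟶ N.toComod hC where
  lin := g.lin.codRestrict N.carrier h
  colinear x := by
    refine hC _ _ _ N.carrier.subtype_injective ?_
    refine (N.coaction_spec hC _).trans ((g.colinear x).trans ?_)
    exact (map_map (g.lin.codRestrict N.carrier h) LinearMap.id N.carrier.subtype LinearMap.id
      (X.ρ x)).symm

theorem Subcomodule.ι_injective (hC : LeftFlat A C) (N : Z.Subcomodule) :
    Function.Injective (N.ι hC).lin := N.carrier.subtype_injective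

instance (hC : LeftFlat A C) (N : Z.Subcomodule) : Mono (N.ι hC) :=
  mono_of_injective _ (N.ι_injective hC)

/-- Composition with `f`, as a linear map over the endomorphism ring of `S`. -/
def postcomp (S : Comod A C) (f : X ⟶ Y) : (S ⟶ X) →ₗ[(End S)ᵐᵒᵖ] (S ⟶ Y) where
  toFun g := g ≫ f
  map_add' g g' := Preadditive.add_comp _ _ _ g g' f
  map_smul' t g := Category.assoc t.unop g f

/-- `Hom(S, -)` applied to an isomorphism. -/
def postcompEquiv (S : Comod A C) (e : X ≅ Y) : (S ⟶ X) ≃ₗ[(End S)ᵐᵒᵖ] (S ⟶ Y) :=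
  LinearEquiv.ofLinearMap (postcomp S e.hom) (postcomp S e.inv)
    (LinearMap.ext fun g => by simp [postcomp]) (LinearMap.ext fun g => by simp [postcomp])

/-! ### The torsion theory of a comodule -/

theorem isTorsion_self (S : Comod A C) : IsTorsion S S := fun _ hL f => hL f

theorem IsTorsion.of_surjective {S : Comod A C} (hX : IsTorsion S X) (f : X ⟶ Y)
    (hf : Function.Surjective f.lin) : IsTorsion S Y := fun L hL g => hom_ext fun y => by
  obtain ⟨x, rfl⟩ := hf y
  exact congrArg (fun k => Hom.lin k x) (hX L hL (f ≫ g))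

theorem IsTorsion.mem_torsionPart {S : Comod A C} (hX : IsTorsion S X) (f : X ⟶ Y) (x : X) :
    f.lin x ∈ (torsionPart S Y).carrier :=
  (le_iSup_of_le X (le_iSup_of_le hX (le_iSup (fun f : X ⟶ Y => LinearMap.range f.lin) f)) :
    LinearMap.range f.lin ≤ (torsionPart S Y).carrier) ⟨x, rfl⟩

theorem isTorsion_radical (hC : LeftFlat A C) (S X : Comod A C) :
    IsTorsion S (radical hC S X) := by
  intro L hL f
  -- the kernel of `f`, inside `X`, contains the image of every map from a torsion comodule
  have h : (torsionPart S X).carrier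
      ≤ (LinearMap.ker f.lin).map (torsionPart S X).carrier.subtype := by
    refine iSup_le fun N => iSup_le fun hN => iSup_le fun g => ?_
    rintro _ ⟨x, rfl⟩
    let g' : N ⟶ radical hC S X := (torsionPart S X).lift hC g (hN.mem_torsionPart g)
    exact ⟨g'.lin x, congrArg (fun k => Hom.lin k x) (hN L hL (g' ≫ f)), rfl⟩
  refine hom_ext fun x => ?_
  obtain ⟨y, hy, e⟩ := h x.2
  rw [← (Subtype.ext e : y = x)]
  exact hy

/-- `Hom(S, r_S(X)) = Hom(S, X)`, because `S` is torsion. -/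
theorem postcomp_radical_bijective (hC : LeftFlat A C) (S X : Comod A C) :
    Function.Bijective (postcomp S ((torsionPart S X).ι hC)) := by
  refine ⟨fun g h e => (cancel_mono ((torsionPart S X).ι hC)).1 e, fun g => ?_⟩
  exact ⟨(torsionPart S X).lift hC g ((isTorsion_self S).mem_torsionPart g), rfl⟩

end

end Comod

open Comod

namespace RationalPairing

variable {A C B : Type u} [Ring A] [AddCommGroup C] [Module A C]
  [Module Aᵐᵒᵖ C] [SMulCommClass A Aᵐᵒᵖ C] [Coring A C] [Ring B]
  (T : RationalPairing A C B)

/-! ### Comodules as rational modules -/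

theorem act_ι (X : Comod A C) (a : A) (x : X) : T.act X (T.ι a) x = op a • x := by
  have h := T.contract_op_smul a 1 (X.ρ x)
  rw [mul_one, ← map_smul, show T.β 1 = Coring.counitₗ A C from T.β_one, X.counit] at h
  exact h.symm

theorem isRational_toMod (X : Comod A C) (x : T.ToMod X) : T.IsRational x := by
  obtain ⟨n, c, y, h⟩ := (X.ρ x).exists_sum
  refine ⟨n, c, y, fun b => ?_⟩
  have h' : T.act X b x = ∑ i, op (T.form (c i) b) • y i := by
    change contractRight (T.β b) (X.ρ x) = _
    rw [h, map_sum]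
    rfl
  refine h'.trans (Finset.sum_congr rfl fun i _ => ?_)
  exact (T.act_ι X _ _).symm

variable {T} in
/-- A `B`-linear map of comodules is colinear. -/
def ofToModMap {X Y : Comod A C} (f : T.ToMod X →ₗ[Bᵐᵒᵖ] T.ToMod Y) : X ⟶ Y where
  lin :=
    { toFun := fun x => f x
      map_add' := fun x y => map_add f x y
      map_smul' := fun a x => by
        have h : f (T.act X (T.ι a.unop) x) = T.act Y (T.ι a.unop) (f x) :=
          map_smul f (op (T.ι a.unop)) (show T.ToMod X from x)
        have h' := T.act_ι Y a.unop (f x)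
        exact (congrArg f (T.act_ι X a.unop x)).symm.trans (h.trans h') }
  colinear x := T.eq_of_contract fun b => by
    rw [contractRight_map, LinearMap.comp_id]
    exact (map_smul f (op b) (show T.ToMod X from x)).symm

section Rat

variable {M : Type u} [AddCommGroup M] [Module Bᵐᵒᵖ M]

variable {T} in
/-- A `B`-linear map from a comodule to a module `M` is a colinear map to `Rat(M)`. -/
def toRat {X : Comod A C} (g : T.ToMod X →ₗ[Bᵐᵒᵖ] M) : X ⟶ T.ratObj M where
  lin :=
    { toFun := fun x => (⟨g x, (T.isRational_toMod X x).map T g⟩ : T.ratSubmodule M)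
      map_add' := fun x y => Subtype.ext (map_add g x y)
      map_smul' := fun a x => Subtype.ext (by
        have h := map_smul g (op (T.ι a.unop)) (show T.ToMod X from x)
        exact (congrArg g (T.act_ι X a.unop x)).symm.trans h) }
  colinear x := T.eq_of_contract fun b => by
    rw [contractRight_map, LinearMap.comp_id]
    erw [T.contract_ratCoaction]
    exact Subtype.ext (map_smul g (op b) (show T.ToMod X from x)).symm

variable {T} in
/-- A colinear map from a comodule to `Rat(M)` as a `B`-linear map to `M`. -/
def ofRat {X : Comod A C} (h : X ⟶ T.ratObj M) : T.ToMod X →ₗ[Bᵐᵒᵖ] M where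
  toFun x := (show T.ratSubmodule M from h.lin x).1
  map_add' x y := congrArg Subtype.val (map_add h.lin x y)
  map_smul' b x := congrArg Subtype.val
    ((T.lin_act h b.unop x).trans (T.contract_ratCoaction M b.unop (h.lin x)))

end Rat

variable {T} in
/-- A `B`-submodule of a comodule is a subcomodule. -/
def subcomodule {X : Comod A C} (K : Submodule Bᵐᵒᵖ (T.ToMod X)) : X.Subcomodule where
  carrier :=
    { carrier := {x | (show T.ToMod X from x) ∈ K}
      zero_mem' := K.zero_mem
      add_mem' := K.add_mem
      smul_mem' := fun a x hx => by
        have h : T.act X (T.ι a.unop) x ∈ (K : Set (T.ToMod X)) :=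
          K.smul_mem (op (T.ι a.unop)) hx
        rw [T.act_ι X a.unop x] at h
        exact h }
  coaction_mem x hx := by
    refine mem_range_of_mkQ _ _ (T.eq_of_contract fun b => ?_)
    rw [contractRight_map, LinearMap.comp_id, map_zero]
    exact (Submodule.Quotient.mk_eq_zero _).2 (K.smul_mem (op b) hx)

theorem injective_of_mono (T : RationalPairing A C B) {X Y : Comod A C} (f : X ⟶ Y) [Mono f] :
    Function.Injective f.lin := by
  let N := subcomodule (LinearMap.ker (T.toModMap f))
  have h : N.ι T.leftFlat = 0 := by
    rw [← cancel_mono f, Limits.zero_comp]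
    exact hom_ext fun x => x.2
  refine (injective_iff_map_eq_zero _).2 fun x hx => ?_
  exact congrArg (fun k => Hom.lin k (⟨x, hx⟩ : N.carrier)) h

/-- The cokernel of a colinear map, as a comodule. -/
def coker {X Y : Comod A C} (f : X ⟶ Y) : Comod A C :=
  T.ratObj (T.ToMod Y ⧸ LinearMap.range (T.toModMap f))

/-- The projection onto the cokernel. -/
def cokerπ {X Y : Comod A C} (f : X ⟶ Y) : Y ⟶ T.coker f :=
  toRat (LinearMap.range (T.toModMap f)).mkQ

theorem cokerπ_surjective {X Y : Comod A C} (f : X ⟶ Y) :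
    Function.Surjective (T.cokerπ f).lin := by
  rintro ⟨q, hq⟩
  obtain ⟨y, rfl⟩ := Submodule.mkQ_surjective _ q
  exact ⟨y, rfl⟩

theorem comp_cokerπ {X Y : Comod A C} (f : X ⟶ Y) : f ≫ T.cokerπ f = 0 :=
  hom_ext fun x => Subtype.ext ((Submodule.Quotient.mk_eq_zero _).2 ⟨x, rfl⟩)

theorem surjective_of_cokerπ_eq_zero {X Y : Comod A C} (f : X ⟶ Y) (h : T.cokerπ f = 0) :
    Function.Surjective f.lin := fun y =>
  (Submodule.Quotient.mk_eq_zero (LinearMap.range (T.toModMap f))).1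
    (congrArg (fun k => Subtype.val (p := (· ∈ T.ratSubmodule _)) (Hom.lin k y)) h)

theorem injective_of_simple (T : RationalPairing A C B) {X Y : Comod A C} [Simple X]
    (f : X ⟶ Y) (hf : f ≠ 0) :
    Function.Injective f.lin := by
  let N := subcomodule (LinearMap.ker (T.toModMap f))
  have h : N.ι T.leftFlat = 0 := by
    by_contra h0
    have := isIso_of_mono_of_nonzero h0
    refine hf (hom_ext fun x => ?_)
    obtain ⟨y, rfl⟩ := (bijective_of_isIso (N.ι T.leftFlat)).2 x
    exact y.2
  refine (injective_iff_map_eq_zero _).2 fun x hx => ?_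
  exact congrArg (fun k => Hom.lin k (⟨x, hx⟩ : N.carrier)) h

theorem surjective_of_simple (T : RationalPairing A C B) {X Y : Comod A C} [Simple Y]
    (f : X ⟶ Y) (hf : f ≠ 0) :
    Function.Surjective f.lin := by
  let N := subcomodule (LinearMap.range (T.toModMap f))
  have h : N.ι T.leftFlat ≠ 0 := by
    intro h0
    refine hf (hom_ext fun x => ?_)
    exact congrArg (fun k => Hom.lin k (⟨f.lin x, x, rfl⟩ : N.carrier)) h0
  have := isIso_of_mono_of_nonzero h
  intro y
  obtain ⟨x, rfl⟩ := (bijective_of_isIso (N.ι T.leftFlat)).2 y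
  exact x.2

/-! ### The dual basis of a finitely generated projective comodule -/

/-- A finitely generated comodule is finitely generated as a `B`-module. -/
theorem exists_span_eq_top (S : Comod A C) (hfg : S.FinitelyGenerated) :
    ∃ s : Finset (T.ToMod S), Submodule.span Bᵐᵒᵖ (s : Set (T.ToMod S)) = ⊤ := by
  classical
  let N (s : Finset (T.ToMod S)) : S.Subcomodule :=
    subcomodule (T := T) (Submodule.span Bᵐᵒᵖ (s : Set (T.ToMod S)))
  let P (s : Finset (T.ToMod S)) : Subobject S := Subobject.mk ((N s).ι T.leftFlat)
  have hP {s t : Finset (T.ToMod S)} (h : s ⊆ t) : P s ≤ P t :=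
    Subobject.mk_le_mk_of_comm ((N t).lift T.leftFlat ((N s).ι T.leftFlat)
      fun x => Submodule.span_mono (R := Bᵐᵒᵖ) (Finset.coe_subset.2 h) x.2) rfl
  obtain ⟨s, hs⟩ := hfg (Set.range P) ⟨_, ∅, rfl⟩ (by
      rintro _ ⟨s, rfl⟩ _ ⟨t, rfl⟩
      exact ⟨_, ⟨s ∪ t, rfl⟩, hP Finset.subset_union_left, hP Finset.subset_union_right⟩)
    ⟨fun _ _ => le_top, fun U hU => by
      have : IsIso U.arrow := by
        refine isIso_of_bijective _ ⟨T.injective_of_mono _, fun x => ?_⟩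
        have hx := hU ⟨{x}, rfl⟩
        have hx' : x ∈ (N {x}).carrier := Submodule.mem_span_of_mem (R := Bᵐᵒᵖ)
          (M := T.ToMod S) (Finset.mem_coe.2 (Finset.mem_singleton_self _))
        exact ⟨(Subobject.ofMkLE _ _ hx).lin (⟨x, hx'⟩ : (N {x}).carrier),
          congrArg (fun k => Hom.lin k (⟨x, hx'⟩ : (N {x}).carrier)) (Subobject.ofMkLE_arrow hx)⟩
      exact (Subobject.eq_top_of_isIso_arrow U).ge⟩
  have := (Subobject.isIso_iff_mk_eq_top _).2 hs
  refine ⟨s, eq_top_iff.2 fun x _ => ?_⟩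
  obtain ⟨y, rfl⟩ := (bijective_of_isIso ((N s).ι T.leftFlat)).2 x
  exact y.2

/-- If `Rat` is exact, a projective comodule has the lifting property with respect to all
surjections of right `B`-modules. -/
theorem exists_lift_of_projective (hT : T.RatExact) (S : Comod A C) [Projective S]
    {M N : Type u} [AddCommGroup M] [Module Bᵐᵒᵖ M] [AddCommGroup N] [Module Bᵐᵒᵖ N]
    (p : M →ₗ[Bᵐᵒᵖ] N) (hp : Function.Surjective p) (g : T.ToMod S →ₗ[Bᵐᵒᵖ] N) :
    ∃ h : T.ToMod S →ₗ[Bᵐᵒᵖ] M, p ∘ₗ h = g := by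
  have := hT.2
  have : Epi (ModuleCat.ofHom p) := (ModuleCat.epi_iff_surjective _).2 hp
  have he : Epi (T.ratMap p) := inferInstanceAs (Epi (T.ratFunctor.map (ModuleCat.ofHom p)))
  refine ⟨ofRat (Projective.factorThru (toRat g) (T.ratMap p)), ?_⟩
  have h := Projective.factorThru_comp (toRat g) (T.ratMap p)
  exact congrArg ofRat h

theorem exists_surjective_of_span_eq_top {M : Type u} [AddCommGroup M] [Module Bᵐᵒᵖ M]
    (s : Finset M) (hs : Submodule.span Bᵐᵒᵖ (s : Set M) = ⊤) :
    ∃ (n : ℕ) (x : Fin n → M) (p : (Fin n → B) →ₗ[Bᵐᵒᵖ] M),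
      Function.Surjective p ∧ ∀ v, p v = ∑ i, op (v i) • x i := by
  let x (i : Fin s.card) : M := s.equivFin.symm i
  let p : (Fin s.card → B) →ₗ[Bᵐᵒᵖ] M :=
    { toFun := fun v => ∑ i, op (v i) • x i
      map_add' := fun v w => by simp [add_smul, Finset.sum_add_distrib]
      map_smul' := fun b v => by simp [Finset.smul_sum, smul_smul] }
  refine ⟨s.card, x, p, ?_, fun v => rfl⟩
  rw [← LinearMap.range_eq_top, eq_top_iff, ← hs, Submodule.span_le]
  intro y hy
  refine ⟨Pi.single (s.equivFin ⟨y, hy⟩) 1, ?_⟩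
  change ∑ i, op ((Pi.single (s.equivFin ⟨y, hy⟩) 1 : Fin s.card → B) i) • x i = y
  rw [Finset.sum_eq_single (s.equivFin ⟨y, hy⟩)]
  · simp [x]
  · intro j _ hj
    simp [hj]
  · simp

/-- Rational exactness makes a finitely generated projective comodule finitely generated projective
over `B`, in the form of a dual basis. -/
theorem exists_dualBasis (hT : T.RatExact) (S : Comod A C) (hfg : S.FinitelyGenerated)
    [Projective S] :
    ∃ (n : ℕ) (x : Fin n → T.ToMod S) (φ : Fin n → T.Dual S),
      ∀ s, ∑ i, op (φ i s) • x i = s := by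
  obtain ⟨s, hs⟩ := T.exists_span_eq_top S hfg
  obtain ⟨n, x, p, hp, h⟩ := exists_surjective_of_span_eq_top s hs
  obtain ⟨σ, hσ⟩ := T.exists_lift_of_projective hT S p hp LinearMap.id
  let φ (i : Fin n) : T.ToMod S →ₗ[Bᵐᵒᵖ] B := LinearMap.proj i ∘ₗ σ
  exact ⟨n, x, φ, fun y => (h (σ y)).symm.trans (LinearMap.congr_fun hσ y)⟩

/-! ### Maps into coinduced comodules -/

variable {T} {S : Comod A C}

/-- The colinear map `s ↦ x φ(s)`. -/
def rankOne {X : Comod A C} (x : T.ToMod X) (φ : T.Dual S) : S ⟶ X :=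
  ofToModMap (T := T)
    { toFun := fun s => op (φ s) • x
      map_add' := fun s s' =>
        (congrArg (fun b => op b • x)
          (LinearMap.map_add (φ : T.ToMod S →ₗ[Bᵐᵒᵖ] B) s s')).trans
            (add_smul (op (φ s)) (op (φ s')) x)
      map_smul' := fun b s =>
        (congrArg (fun b => op b • x)
          (LinearMap.map_smul (φ : T.ToMod S →ₗ[Bᵐᵒᵖ] B) b s)).trans
            (mul_smul b (op (φ s)) x) }

theorem rankOne_add_left {X : Comod A C} (x x' : T.ToMod X) (φ : T.Dual S) :
    rankOne (x + x') φ = rankOne x φ + rankOne x' φ :=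
  hom_ext fun s => smul_add (op (φ s)) x x'

theorem rankOne_add_right {X : Comod A C} (x : T.ToMod X) (φ φ' : T.Dual S) :
    rankOne x (φ + φ') = rankOne x φ + rankOne x φ' :=
  hom_ext fun s => add_smul (op (φ s)) (op (φ' s)) x

theorem rankOne_smul_left {X : Comod A C} (b : B) (x : T.ToMod X) (φ : T.Dual S) :
    rankOne (op b • x) φ = rankOne x (b • φ) :=
  hom_ext fun s => smul_smul (op (φ s)) (op b) x

theorem rankOne_smul_right {X : Comod A C} (x : T.ToMod X) (t : (End S)ᵐᵒᵖ) (φ : T.Dual S) :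
    rankOne x (t • φ) = t • rankOne x φ := rfl

theorem rankOne_comp {X Y : Comod A C} (x : T.ToMod X) (φ : T.Dual S) (f : X ⟶ Y) :
    rankOne x φ ≫ f = rankOne (T.toModMap f x) φ :=
  hom_ext fun s => map_smul (T.toModMap f) (op (φ s)) x

/-- The right action of a rank one endomorphism on the dual: `ψ ∘ (s ↦ x φ(s)) = ψ(x) φ`. -/
theorem op_rankOne_smul (x : T.ToMod S) (φ ψ : T.Dual S) :
    op (End.of (rankOne x φ)) • ψ = ψ x • φ :=
  LinearMap.ext fun s => LinearMap.map_smul (ψ : T.ToMod S →ₗ[Bᵐᵒᵖ] B) (op (φ s)) x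

section

variable {n : ℕ} {x : Fin n → T.ToMod S} {φ : Fin n → T.Dual S}

theorem sum_rankOne (hx : ∀ s, ∑ i, op (φ i s) • x i = s) {X : Comod A C} (f : S ⟶ X) :
    ∑ i, rankOne (T.toModMap f (x i)) (φ i) = f := by
  refine hom_ext fun s => ?_
  let ev : (S ⟶ X) →+ X := ⟨⟨fun g => g.lin s, rfl⟩, fun _ _ => rfl⟩
  change ev _ = T.toModMap f s
  rw [map_sum, ← hx s, map_sum]
  exact Finset.sum_congr rfl fun i _ => (map_smul (T.toModMap f) (op (φ i s)) (x i)).symm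

theorem sum_dual_smul (hx : ∀ s, ∑ i, op (φ i s) • x i = s) (ψ : T.Dual S) :
    ∑ i, ψ (x i) • φ i = ψ := by
  refine LinearMap.ext fun s => ?_
  refine (LinearMap.sum_apply (M := T.ToMod S) (M₂ := B) _ _ s).trans ?_
  refine Eq.trans ?_ (congrArg ψ (hx s))
  refine Eq.trans ?_ (map_sum (show T.ToMod S →ₗ[Bᵐᵒᵖ] B from ψ) _ _).symm
  exact Finset.sum_congr rfl fun i _ =>
    (LinearMap.map_smul (ψ : T.ToMod S →ₗ[Bᵐᵒᵖ] B) (op (φ i s)) (x i)).symm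

end

variable {Y : Type u} [AddCommGroup Y] [Module (End S)ᵐᵒᵖ Y]

/-- The colinear map `X → Coind(Y)`, `x ↦ [φ ↦ g(s ↦ x φ(s))]`, of a linear map
`g : Hom(S, X) → Y`. -/
def coindLift {X : Comod A C} (g : (S ⟶ X) →ₗ[(End S)ᵐᵒᵖ] Y) : X ⟶ T.coind S Y :=
  toRat (M := T.HomDual S Y)
    { toFun := fun x =>
        ({ toFun := fun φ => g (rankOne x φ)
           map_add' := fun φ φ' => by rw [rankOne_add_right, map_add]
           map_smul' := fun t φ => by rw [rankOne_smul_right, map_smul, RingHom.id_apply] } :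
          T.Dual S →ₗ[(End S)ᵐᵒᵖ] Y)
      map_add' := fun x x' => LinearMap.ext fun φ =>
        (congrArg g (rankOne_add_left x x' φ)).trans (map_add g _ _)
      map_smul' := fun b x => LinearMap.ext fun φ =>
        congrArg g (rankOne_smul_left b.unop x φ) }

theorem ofRat_coindLift {X : Comod A C} (g : (S ⟶ X) →ₗ[(End S)ᵐᵒᵖ] Y) (x : T.ToMod X)
    (φ : T.Dual S) : (ofRat (coindLift g) x : T.HomDual S Y) φ = g (rankOne x φ) := rfl

theorem coind_hom_ext {X : Comod A C} {f g : X ⟶ T.coind S Y}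
    (h : ∀ (x : T.ToMod X) (φ : T.Dual S),
      (ofRat f x : T.HomDual S Y) φ = (ofRat g x : T.HomDual S Y) φ) : f = g :=
  hom_ext fun x => Subtype.ext (LinearMap.ext (h x))

section

variable {n : ℕ} {x : Fin n → T.ToMod S} {φ : Fin n → T.Dual S}

/-- `g` is determined by its values on rank one maps, as these sum up to every `f : S ⟶ X`. -/
theorem coindLift_ne_zero (hx : ∀ s, ∑ i, op (φ i s) • x i = s) {X : Comod A C}
    {g : (S ⟶ X) →ₗ[(End S)ᵐᵒᵖ] Y} (hg : g ≠ 0) : coindLift g ≠ (0 : X ⟶ T.coind S Y) := by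
  intro h
  refine hg (LinearMap.ext fun f => ?_)
  rw [← sum_rankOne hx f, map_sum]
  refine Finset.sum_eq_zero fun i _ => ?_
  rw [← ofRat_coindLift, h]
  rfl

theorem ofRat_smul {X : Comod A C} (f : X ⟶ T.coind S Y) (b : B) (z : T.ToMod X) (ψ : T.Dual S) :
    (ofRat f z : T.HomDual S Y) (b • ψ) = (ofRat f (op b • z) : T.HomDual S Y) ψ :=
  (DFunLike.congr_fun (map_smul (ofRat (M := T.HomDual S Y) f) (op b) z) ψ).symm

/-- A map to `Coind(Y)` is recovered from its values on the images of rank one maps. -/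
theorem ofRat_eq_sum (hx : ∀ s, ∑ i, op (φ i s) • x i = s) {X : Comod A C}
    (f : X ⟶ T.coind S Y) (z : T.ToMod X) (ψ : T.Dual S) :
    (ofRat f z : T.HomDual S Y) ψ
      = ∑ i, (ofRat f (T.toModMap (rankOne z ψ) (x i)) : T.HomDual S Y) (φ i) := by
  conv_lhs => rw [← sum_dual_smul hx ψ]
  refine (map_sum (show T.Dual S →ₗ[(End S)ᵐᵒᵖ] Y from ofRat f z) _ _).trans ?_
  exact Finset.sum_congr rfl fun i _ => ofRat_smul f _ z _

/-- A comodule `X` with `Hom(S, X) = 0` has no nonzero map to a coinduced comodule: the rank one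
maps `S → X`, which determine such a map, all vanish. -/
theorem hom_coind_eq_zero (hx : ∀ s, ∑ i, op (φ i s) • x i = s) {X : Comod A C}
    (hX : IsTorsionFree S X) (f : X ⟶ T.coind S Y) : f = 0 := by
  refine coind_hom_ext fun z ψ => ?_
  rw [ofRat_eq_sum hx]
  refine Finset.sum_eq_zero fun i _ => ?_
  rw [hX (rankOne z ψ), show T.toModMap (0 : S ⟶ X) (x i) = 0 from rfl, map_zero]
  rfl

/-- The map `Y → Hom(S, Coind(Y))` which sends `y` to `s ↦ [φ ↦ y (s φ)]`. -/
def toHomCoind (T : RationalPairing A C B) (S : Comod A C) (Y : Type u) [AddCommGroup Y]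
    [Module (End S)ᵐᵒᵖ Y] : Y →ₗ[(End S)ᵐᵒᵖ] (S ⟶ T.coind S Y) where
  toFun y := coindLift
    { toFun := fun t : S ⟶ S => (op (End.of t) : (End S)ᵐᵒᵖ) • y
      map_add' := fun t t' => add_smul (op (End.of t)) (op (End.of t')) y
      map_smul' := fun r t => mul_smul r (op (End.of t)) y }
  map_add' y y' := coind_hom_ext fun _ _ => smul_add _ y y'
  map_smul' t y := coind_hom_ext fun z ψ => by
    refine (smul_smul (op (End.of (rankOne z ψ))) t y).trans ?_
    exact congrArg (fun u : S ⟶ S => (op (End.of u) : (End S)ᵐᵒᵖ) • y)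
      (rankOne_comp z ψ t.unop)

theorem ofRat_toHomCoind (y : Y) (z : T.ToMod S) (ψ : T.Dual S) :
    (ofRat (toHomCoind T S Y y) z : T.HomDual S Y) ψ
      = (op (End.of (rankOne z ψ)) : (End S)ᵐᵒᵖ) • y := rfl

theorem toHomCoind_bijective (hx : ∀ s, ∑ i, op (φ i s) • x i = s) :
    Function.Bijective (toHomCoind T S Y) := by
  constructor
  · refine (injective_iff_map_eq_zero _).2 fun y hy => ?_
    have h1 : (1 : (End S)ᵐᵒᵖ) = ∑ i, op (End.of (rankOne (x i) (φ i))) := by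
      refine MulOpposite.unop_injective ?_
      refine Eq.trans ?_ (Finset.unop_sum _ _).symm
      exact (sum_rankOne hx (𝟙 S)).symm
    rw [← one_smul (End S)ᵐᵒᵖ y, h1, Finset.sum_smul]
    refine Finset.sum_eq_zero fun i _ => ?_
    rw [← ofRat_toHomCoind, hy]
    rfl
  · intro f
    refine ⟨∑ i, (ofRat f (x i) : T.HomDual S Y) (φ i), coind_hom_ext fun z ψ => ?_⟩
    rw [ofRat_toHomCoind, Finset.smul_sum]
    conv_rhs => rw [← hx z, map_sum]
    refine Eq.trans ?_ (LinearMap.sum_apply (M := T.Dual S) (M₂ := Y) _ _ ψ).symm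
    refine Finset.sum_congr rfl fun i _ => Eq.trans ?_ (ofRat_smul f (φ i z) (x i) ψ)
    rw [← op_rankOne_smul]
    exact (LinearMap.map_smul (show T.Dual S →ₗ[(End S)ᵐᵒᵖ] Y from ofRat f (x i)) _ _).symm

/-- `Y ≅ Hom(S, r_S(Coind(Y)))`. -/
def homTorsionCoindEquiv (hx : ∀ s, ∑ i, op (φ i s) • x i = s) :
    Y ≃ₗ[(End S)ᵐᵒᵖ] (S ⟶ T.torsionCoind S Y) :=
  (LinearEquiv.ofBijective _ (toHomCoind_bijective hx)).trans
    (LinearEquiv.ofBijective _ (postcomp_radical_bijective T.leftFlat S (T.coind S Y))).symm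

/-! ### Simple comodules and simple modules -/

theorem exists_comp_eq {X : Comod A C} [IsSimpleModule (End S)ᵐᵒᵖ (S ⟶ X)] {f : S ⟶ X}
    (hf : f ≠ 0) (g : S ⟶ X) : ∃ t : S ⟶ S, t ≫ f = g := by
  obtain ⟨t, ht⟩ := IsSimpleModule.toSpanSingleton_surjective (End S)ᵐᵒᵖ hf g
  exact ⟨t.unop, ht⟩

theorem simple_torsionCoind [Projective S] (hx : ∀ s, ∑ i, op (φ i s) • x i = s)
    (hY : IsSimpleModule (End S)ᵐᵒᵖ Y) : Simple (T.torsionCoind S Y) := by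
  have hR : IsSimpleModule (End S)ᵐᵒᵖ (S ⟶ T.torsionCoind S Y) :=
    IsSimpleModule.congr (homTorsionCoindEquiv hx).symm
  let j : T.torsionCoind S Y ⟶ T.coind S Y := (torsionPart S (T.coind S Y)).ι T.leftFlat
  have hj : Mono j := inferInstanceAs (Mono ((torsionPart S (T.coind S Y)).ι T.leftFlat))
  refine ⟨fun {K} f _ => ⟨fun hf h0 => ?_, fun hf => ?_⟩⟩
  · have := IsSimpleModule.nontrivial (End S)ᵐᵒᵖ (S ⟶ T.torsionCoind S Y)
    obtain ⟨g, hg⟩ := exists_ne (0 : S ⟶ T.torsionCoind S Y)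
    refine hg ?_
    rw [← Category.comp_id g, ← IsIso.inv_hom_id f, ← Category.assoc]
    exact (congrArg (fun k => (g ≫ inv f) ≫ k) h0).trans Limits.comp_zero
  · obtain ⟨k, hk⟩ : ∃ k : S ⟶ K, k ≠ 0 := by
      by_contra! h
      refine hf ?_
      rw [← cancel_mono j, Limits.zero_comp]
      exact hom_coind_eq_zero hx h _
    have hkf : k ≫ f ≠ 0 := fun h => hk (by rwa [← cancel_mono f, Limits.zero_comp])
    have hπ : Epi (T.cokerπ f) := epi_of_surjective _ (T.cokerπ_surjective f)
    -- every map from `S` to the cokernel lifts along the projection and then factors through `f`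
    have hQ : IsTorsionFree S (T.coker f) := by
      intro q
      obtain ⟨t, ht⟩ := exists_comp_eq hkf (Projective.factorThru q (T.cokerπ f))
      rw [← Projective.factorThru_comp q (T.cokerπ f), ← ht, Category.assoc, Category.assoc,
        T.comp_cokerπ, Limits.comp_zero, Limits.comp_zero]
    exact isIso_of_bijective f ⟨T.injective_of_mono f, T.surjective_of_cokerπ_eq_zero f
      (isTorsion_radical T.leftFlat S (T.coind S Y) _ hQ _)⟩

/-- Every nonzero map from the projective `S` to the simple comodule `X` is an epimorphism, so it
generates `Hom(S, X)`. -/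
theorem isSimpleModule_hom [Projective S] (T : RationalPairing A C B) {X : Comod A C} [Simple X]
    {f : S ⟶ X} (hf : f ≠ 0) : IsSimpleModule (End S)ᵐᵒᵖ (S ⟶ X) := by
  rw [isSimpleModule_iff_toSpanSingleton_surjective]
  refine ⟨⟨f, 0, hf⟩, fun g hg h => ?_⟩
  have : Epi g := epi_of_surjective g (T.surjective_of_simple g hg)
  exact ⟨op (End.of (Projective.factorThru h g)), Projective.factorThru_comp h g⟩

/-- A simple comodule `X` with `Hom(S, X) ≅ Y` simple is `r_S(Coind(Y))`. -/
theorem nonempty_iso_torsionCoind [Projective S] (hx : ∀ s, ∑ i, op (φ i s) • x i = s)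
    (hY : IsSimpleModule (End S)ᵐᵒᵖ Y) {X : Comod A C} [Simple X]
    (e : (S ⟶ X) ≃ₗ[(End S)ᵐᵒᵖ] Y) : Nonempty (X ≅ T.torsionCoind S Y) := by
  have := IsSimpleModule.nontrivial (End S)ᵐᵒᵖ Y
  obtain ⟨y, hy⟩ := exists_ne (0 : Y)
  have he : e.toLinearMap ≠ 0 := fun h => hy (by
    rw [← e.apply_symm_apply y]
    exact LinearMap.congr_fun h (e.symm y))
  have hf : e.symm y ≠ 0 := by simpa using hy
  have hX : IsTorsion S X := (isTorsion_self S).of_surjective _ (T.surjective_of_simple _ hf)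
  let l : X ⟶ T.torsionCoind S Y := (torsionPart S (T.coind S Y)).lift T.leftFlat
    (coindLift e.toLinearMap) (hX.mem_torsionPart _)
  have hl : l ≠ 0 := fun h => coindLift_ne_zero (T := T) hx he
    (congrArg (· ≫ (torsionPart S (T.coind S Y)).ι T.leftFlat) h)
  have := simple_torsionCoind (T := T) hx hY
  have := isIso_of_bijective l ⟨T.injective_of_simple l hl, T.surjective_of_simple l hl⟩
  exact ⟨asIso l⟩

end

end RationalPairing

end

end Corings

theorem mainTheorem1 {A C B : Type u} [Ring A] [AddCommGroup C] [Module A C] [Module Aᵐᵒᵖ C]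
    [SMulCommClass A Aᵐᵒᵖ C] [Coring A C] [Ring B] (T : RationalPairing A C B)
    (hT : T.RatExact) (S : Comod A C) (hfg : S.FinitelyGenerated) (hproj : Projective S) :
    ((∀ (Y : Type u) [AddCommGroup Y] [Module (End S)ᵐᵒᵖ Y], IsSimpleModule (End S)ᵐᵒᵖ Y →
        Simple (T.torsionCoind S Y) ∧
          Nonempty (Y ≃ₗ[(End S)ᵐᵒᵖ] (S ⟶ T.torsionCoind S Y))) ∧
      ∀ (Y Y' : Type u) [AddCommGroup Y] [Module (End S)ᵐᵒᵖ Y] [AddCommGroup Y']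
        [Module (End S)ᵐᵒᵖ Y'], IsSimpleModule (End S)ᵐᵒᵖ Y → IsSimpleModule (End S)ᵐᵒᵖ Y' →
        (Nonempty (Y ≃ₗ[(End S)ᵐᵒᵖ] Y') ↔
          Nonempty (T.torsionCoind S Y ≅ T.torsionCoind S Y'))) ∧
    ∀ X : Comod A C, Simple X → (∃ f : S ⟶ X, f ≠ 0) →
      IsSimpleModule (End S)ᵐᵒᵖ (S ⟶ X) ∧
        Nonempty (X ≅ T.torsionCoind S (S ⟶ X)) := by
  obtain ⟨n, x, φ, hx⟩ := T.exists_dualBasis hT S hfg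
  refine ⟨⟨fun Y _ _ hY => ⟨RationalPairing.simple_torsionCoind hx hY,
    ⟨RationalPairing.homTorsionCoindEquiv hx⟩⟩, fun Y Y' _ _ _ _ hY hY' => ⟨?_, ?_⟩⟩, ?_⟩
  · rintro ⟨e⟩
    have := RationalPairing.simple_torsionCoind (T := T) hx hY
    exact RationalPairing.nonempty_iso_torsionCoind hx hY'
      ((RationalPairing.homTorsionCoindEquiv hx).symm.trans e)
  · rintro ⟨i⟩
    exact ⟨((RationalPairing.homTorsionCoindEquiv hx).trans (Comod.postcompEquiv S i)).trans
      (RationalPairing.homTorsionCoindEquiv hx).symm⟩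
  · rintro X hX ⟨f, hf⟩
    have h := RationalPairing.isSimpleModule_hom T hf
    exact ⟨h, RationalPairing.nonempty_iso_torsionCoind hx h (LinearEquiv.refl _ _)⟩
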